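/- For a positive integer $n$ and a real $\theta>0$ let $(\theta)_n=\theta(\theta+1)\cdots(\theta+n-1)$, let $\bar s(n,x)$ be the coefficient of $\theta^x$ in $(\theta)_n$, and let $K=K_{n,\theta}$ be a random variable with $P(K=x)=\bar s(n,x)\theta^x/(\theta)_n$ for $x=1,\dots,n$. Let $F_{n,\theta}$ be the distribution function of $(K-\mathrm E[K])/\sqrt{\mathrm{var}(K)}$, let $\Phi$ be the standard normal distribution function, and $\|f\|_\infty=\sup_{x\in\mathbb R}|f(x)|$. Put \[ V^-=\theta\Bigl(\log\bigl(1+\tfrac n\theta\bigr)-1+\tfrac{\theta}{n+\theta}\Bigr)+\tfrac{n}{2(\theta+n)}-1,\qquad V^+=\theta\Bigl(\log\bigl(1+\tfrac n\theta\bigr)-1+\tfrac{\theta}{n+\theta}\Bigr)+\tfrac{n}{\theta+n}, \] \[ M=\theta\Bigl\{\log\bigl(1+\tfrac n\theta\bigr)-2+\tfrac{3\theta}{n+\theta}-\tfrac{\theta^2}{(n+\theta)^2}\Bigr\},\qquad T^-=M-3+\tfrac{n}{2(n+\theta)},\qquad T^+=M+2+\tfrac{n}{n+\theta}, \] \[ \gamma_2=\frac{T^-}{(V^+)^{3/2}},\qquad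 \gamma_3=\frac{\theta\bigl\{\frac13-\frac{\theta}{n+\theta}+\frac{\theta^2}{(n+\theta)^2}-\frac{\theta^3}{3(n+\theta)^3}\bigr\}+2}{(V^-)^2},\qquad \gamma_4=\frac{-T^+}{(V^+)^{3/2}}. \] Call $D>0$ a Hall–Barbour constant if for every $m$ and all independent random variables $Y_1,\dots,Y_m$ with $\mathrm E[Y_i]=0$, $\mathrm E[Y_i^2]=\sigma_i^2\in(0,\infty)$ and $\sum_{i=1}^m\sigma_i^2=1$, \[ \sum_{i=1}^m \mathrm E\bigl[Y_i^2\mathbf 1\{|Y_i|>1\}\bigr]+\sum_{i=1}^m \mathrm E\bigl[Y_i^4\mathbf 1\{|Y_i|\le1\}\bigr]+\Bigl|\sum_{i=1}^m \mathrm E\bigl[Y_i^3\mathbf 1\{|Y_i|\le1\}\bigr]\Bigr|\le D\Bigl(\|F^Y-\Phi\|_\infty+\sum_{i=1}^m\sigma_i^4\Bigr), \] where $F^Y$ is the distribution function of $\sum_{i=1}^m Y_i$. Theorem. A Hall–Barbour constant exists. Let $D$ be any such constant (it depends on neither $n$ nor $\theta$), and let $n\ge1$ and $\theta>0$ be such that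 $V^->0$ and $\mathrm{var}(K)\ge1$. (i) If $T^->0$, then $\|F_{n,\theta}-\Phi\|_\infty\ge \gamma_2/D-\gamma_3$. (ii) If $T^+<0$, then $\|F_{n,\theta}-\Phi\|_\infty\ge \gamma_4/D-\gamma_3$. -/

import Mathlib

open MeasureTheory ProbabilityTheory

noncomputable section

namespace EwensLength

/-- `P(K = x) = s(n,x) θ^x / (θ)_n`, where `(θ)_n = θ(θ+1)⋯(θ+n-1)` and `s(n,x)` is the
coefficient of `θ^x` in the rising factorial `(θ)_n`. -/
def prob (n : ℕ) (θ : ℝ) (x : ℕ) : ℝ :=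
  (ascPochhammer ℝ n).coeff x * θ ^ x / (ascPochhammer ℝ n).eval θ

/-- The random variable `K` follows the distribution of the length of an Ewens partition. -/
def HasEwensLaw {Ω : Type*} [MeasurableSpace Ω] (P : Measure Ω) (n : ℕ) (θ : ℝ)
    (K : Ω → ℕ) : Prop :=
  Measurable K ∧ ∀ x ∈ Finset.Icc 1 n, P.real {ω | K ω = x} = prob n θ x

/-- The sup-distance `‖F - G‖_∞` between the distribution functions of two laws on `ℝ`. -/
def supDist (μ ν : Measure ℝ) : ℝ := ⨆ x : ℝ, |cdf μ x - cdf ν x|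

/-- `‖F_{n,θ} - Φ‖_∞`: `F_{n,θ}` is the distribution function of `(K - E K) / √(var K)`. -/
def normalError {Ω : Type*} [MeasurableSpace Ω] (P : Measure Ω) (K : Ω → ℕ) : ℝ :=
  supDist
    (P.map fun ω => ((K ω : ℝ) - ∫ ω', (K ω' : ℝ) ∂P) / √(variance (fun ω' => (K ω' : ℝ)) P))
    (gaussianReal 0 1)

/-- `δ = ∑ E[Y_i² 1{|Y_i|>1}] + ∑ E[Y_i⁴ 1{|Y_i|≤1}] + |∑ E[Y_i³ 1{|Y_i|≤1}]|`. -/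
def hallBarbourDelta {Ω : Type*} [MeasurableSpace Ω] (P : Measure Ω) {m : ℕ}
    (Y : Fin m → Ω → ℝ) : ℝ :=
  (∑ i, ∫ ω in {ω | 1 < |Y i ω|}, Y i ω ^ 2 ∂P)
    + (∑ i, ∫ ω in {ω | |Y i ω| ≤ 1}, Y i ω ^ 4 ∂P)
    + |∑ i, ∫ ω in {ω | |Y i ω| ≤ 1}, Y i ω ^ 3 ∂P|

/-- `D` is a universal constant for the reversed Berry–Esseen inequality of Hall and Barbour:
`δ ≤ D (‖F^Y - Φ‖_∞ + ∑ σ_i⁴)` for all independent centred `Y_1, …, Y_m` with variances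
`σ_i² > 0` adding up to one, where `F^Y` is the distribution function of `∑ Y_i`. -/
def IsHallBarbourConstant (D : ℝ) : Prop :=
  0 < D ∧
  ∀ (Ω : Type) [MeasurableSpace Ω] (P : Measure Ω) [IsProbabilityMeasure P]
    (m : ℕ) (Y : Fin m → Ω → ℝ),
    (∀ i, Measurable (Y i)) → iIndepFun Y P → (∀ i, MemLp (Y i) 2 P) →
    (∀ i, ∫ ω, Y i ω ∂P = 0) → (∀ i, 0 < ∫ ω, Y i ω ^ 2 ∂P) →
    (∑ i, ∫ ω, Y i ω ^ 2 ∂P = 1) →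
    hallBarbourDelta P Y ≤
      D * (supDist (P.map fun ω => ∑ i, Y i ω) (gaussianReal 0 1)
        + ∑ i, (∫ ω, Y i ω ^ 2 ∂P) ^ 2)

/-- The explicit lower bound for the variance. -/
def varLower (n : ℕ) (θ : ℝ) : ℝ :=
  θ * (Real.log (1 + n / θ) - 1 + θ / (n + θ)) + n / (2 * (θ + n)) - 1

/-- The explicit upper bound for the variance. -/
def varUpper (n : ℕ) (θ : ℝ) : ℝ :=
  θ * (Real.log (1 + n / θ) - 1 + θ / (n + θ)) + n / (θ + n)

/-- The explicit lower bound for the third central moment. -/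
def thirdLower (n : ℕ) (θ : ℝ) : ℝ :=
  θ * (Real.log (1 + n / θ) - 2 + 3 * θ / (n + θ) - θ ^ 2 / (n + θ) ^ 2) - 3
    + n / (2 * (n + θ))

/-- The explicit upper bound for the third central moment. -/
def thirdUpper (n : ℕ) (θ : ℝ) : ℝ :=
  θ * (Real.log (1 + n / θ) - 2 + 3 * θ / (n + θ) - θ ^ 2 / (n + θ) ^ 2) + 2
    + n / (n + θ)

def gamma2 (n : ℕ) (θ : ℝ) : ℝ := thirdLower n θ / varUpper n θ ^ (3 / 2 : ℝ)

def gamma3 (n : ℕ) (θ : ℝ) : ℝ :=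
  (θ * (1 / 3 - θ / (n + θ) + θ ^ 2 / (n + θ) ^ 2 - θ ^ 3 / (3 * (n + θ) ^ 3)) + 2)
    / varLower n θ ^ 2

def gamma4 (n : ℕ) (θ : ℝ) : ℝ := -thirdUpper n θ / varUpper n θ ^ (3 / 2 : ℝ)

end EwensLength

end

/-!
**Existence of a Hall–Barbour constant.** The proof is Stein's method. Let `W = ∑ Y_i`, let `N` be
standard normal, and let `f` be a polynomial times `e^{-x²/2}`; this class is closed under
differentiation, and all its members are bounded, integrable and vanish at infinity. Two facts
carry the argument.

* Integration by parts against the distribution function gives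
  `|E g(W) - E g(N)| ≤ ‖F_W - Φ‖_∞ ∫ |g'|` (`abs_integral_polyGauss_sub_le`).
* Put `u(y) = E f(N + y)` and `v_i(y) = E f(W - Y_i + y)`. The derivatives of `u` and `v_i` differ by
  `O(‖F_W - Φ‖_∞ + σ_i²)` uniformly, so that
  `E[Y_i f(W)] = E[Y_i (v_i(Y_i) - v_i(0))]` is `E[Y_i (u(Y_i) - u(0))]` up to
  `O(σ_i² (‖F_W - Φ‖_∞ + σ_i²))` (`exists_abs_stein_term_sub_le`).

Summing over `i`, and comparing `E[W f(W)]` with `E[N f(N)] = u'(0)`, bounds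
`|∑ E[Y_i (u(Y_i) - u(0) - Y_i u'(0))]|` by a multiple of `‖F_W - Φ‖_∞ + ∑ σ_i⁴`
(`exists_abs_sum_remainder_le`). For `f(x) = x e^{-x²/2}` the summand is a negative multiple of
`Y² (1 - e^{-Y²/4})`, which dominates `Y² 1{|Y| > 1} + Y⁴ 1{|Y| ≤ 1}`; for `f(x) = e^{-x²/2}` it is a
multiple of `Y (1 - e^{-Y²/4})`, which is `Y³ 1{|Y| ≤ 1} / 4` up to that same quantity.

**The lower bounds.** By factoring its generating function, `K` has the law of one plus a sum of
independent Bernoulli variables with success probabilities `p_j = θ / (θ + j)`, `1 ≤ j < n`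
(`HasEwensLaw.identDistrib`). Since `var K ≥ 1`, the standardized summands are bounded by one, and
the Hall–Barbour inequality bounds the third central moment
`∑ p_j (1 - p_j) (1 - 2 p_j)` divided by `(var K)^{3/2}`. The three sums that occur (variance, third
moment, sum of squared variances) are compared with integrals of explicit primitives; as functions
of `p_j` the summands are Lipschitz, and `p_j` is monotone in `j`, so the errors telescope
(`sum_sub_le_of_hasDerivAt`).
-/

namespace EwensLength

/-! ### Polynomials times the Gaussian weight, and the sup-distance -/

section PolyGauss

open Polynomial

/-- The function `x ↦ p(x) e^{-x²/2}` for a real polynomial `p`. -/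
noncomputable def polyGauss (p : ℝ[X]) (x : ℝ) : ℝ := p.eval x * Real.exp (-x ^ 2 / 2)

/-- The polynomial `p' - X p`, so that `polyGauss (stepPoly p)` is the derivative of
`polyGauss p`. -/
noncomputable def stepPoly (p : ℝ[X]) : ℝ[X] := derivative p - X * p

theorem hasDerivAt_polyGauss (p : ℝ[X]) (x : ℝ) :
    HasDerivAt (polyGauss p) (polyGauss (stepPoly p) x) x := by
  have h1 : HasDerivAt (fun x : ℝ => -x ^ 2 / 2) (-x) x := by
    have := ((hasDerivAt_pow 2 x).neg).div_const 2
    convert! this using 1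
    simp only [Nat.cast_ofNat]
    ring
  convert! (p.hasDerivAt x).mul h1.exp using 1
  simp only [polyGauss, stepPoly, eval_sub, eval_mul, eval_X]
  ring

theorem continuous_polyGauss (p : ℝ[X]) : Continuous (polyGauss p) :=
  continuous_iff_continuousAt.2 fun x => (hasDerivAt_polyGauss p x).continuousAt

/-- Any `b < 1 / 2` would do for the exponent `b x²`: it leaves Gaussian decay after multiplication
by the weight. -/
theorem exists_abs_eval_le_exp (p : ℝ[X]) :
    ∃ C, 0 ≤ C ∧ ∀ x : ℝ, |p.eval x| ≤ C * Real.exp (x ^ 2 / 4) := by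
  induction p using Polynomial.induction_on' with
  | add p q hp hq =>
    obtain ⟨C, hC, h⟩ := hp
    obtain ⟨C', hC', h'⟩ := hq
    refine ⟨C + C', by positivity, fun x => ?_⟩
    rw [eval_add, add_mul]
    exact (abs_add_le _ _).trans (add_le_add (h x) (h' x))
  | monomial k a =>
    refine ⟨|a| * (1 + 4 ^ k * k.factorial), by positivity, fun x => ?_⟩
    have h1 : 1 ≤ Real.exp (x ^ 2 / 4) := Real.one_le_exp (by positivity)
    have h2 : (x ^ 2) ^ k ≤ 4 ^ k * k.factorial * Real.exp (x ^ 2 / 4) := by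
      have := Real.pow_div_factorial_le_exp (x ^ 2 / 4) (by positivity) k
      rw [div_pow, div_div, div_le_iff₀ (by positivity)] at this
      linarith
    have h3 : |x| ^ k ≤ 1 + (x ^ 2) ^ k := by
      have : (x ^ 2) ^ k = (|x| ^ k) ^ 2 := by rw [← sq_abs, ← pow_mul, ← pow_mul, mul_comm]
      rw [this]
      nlinarith [sq_nonneg (|x| ^ k - 1)]
    rw [eval_monomial, abs_mul, abs_pow, mul_assoc]
    refine mul_le_mul_of_nonneg_left ?_ (abs_nonneg a)
    linarith

theorem exists_abs_polyGauss_le (p : ℝ[X]) :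
    ∃ C, 0 ≤ C ∧ ∀ x : ℝ, |polyGauss p x| ≤ C * Real.exp (-(1 / 4) * x ^ 2) := by
  obtain ⟨C, hC, h⟩ := exists_abs_eval_le_exp p
  refine ⟨C, hC, fun x => ?_⟩
  rw [polyGauss, abs_mul, Real.abs_exp]
  refine (mul_le_mul_of_nonneg_right (h x) (Real.exp_pos _).le).trans_eq ?_
  rw [mul_assoc, ← Real.exp_add]
  ring_nf

theorem exists_abs_polyGauss_le_const (p : ℝ[X]) :
    ∃ C, 0 ≤ C ∧ ∀ x : ℝ, |polyGauss p x| ≤ C := by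
  obtain ⟨C, hC, h⟩ := exists_abs_polyGauss_le p
  refine ⟨C, hC, fun x => (h x).trans (mul_le_of_le_one_right hC (Real.exp_le_one_iff.2 ?_))⟩
  nlinarith [sq_nonneg x]

theorem integrable_polyGauss (p : ℝ[X]) : Integrable (polyGauss p) := by
  obtain ⟨C, hC, h⟩ := exists_abs_polyGauss_le p
  exact ((integrable_exp_neg_mul_sq (b := 1 / 4) (by norm_num)).const_mul C).mono'
    (continuous_polyGauss p).aestronglyMeasurable (ae_of_all _ h)

theorem tendsto_polyGauss_atTop (p : ℝ[X]) :
    Filter.Tendsto (polyGauss p) Filter.atTop (nhds 0) := by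
  obtain ⟨C, hC, h⟩ := exists_abs_polyGauss_le p
  refine squeeze_zero_norm h ?_
  have h1 : Filter.Tendsto (fun x : ℝ => -(1 / 4) * x ^ 2) Filter.atTop Filter.atBot :=
    (Filter.tendsto_pow_atTop two_ne_zero).const_mul_atTop_of_neg (by norm_num)
  simpa using (Real.tendsto_exp_atBot.comp h1).const_mul C

theorem integral_indicator_Ici_polyGauss (p : ℝ[X]) (w : ℝ) :
    ∫ t, (Set.Ici w).indicator (polyGauss (stepPoly p)) t = -polyGauss p w := by
  rw [integral_indicator measurableSet_Ici, integral_Ici_eq_integral_Ioi,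
    integral_Ioi_of_hasDerivAt_of_tendsto (continuous_polyGauss p).continuousWithinAt
      (fun x _ => hasDerivAt_polyGauss p x) (integrable_polyGauss _).integrableOn
      (tendsto_polyGauss_atTop p), zero_sub]

/-- Expectation as an integral against the distribution function (integration by parts). -/
theorem integral_polyGauss_eq (μ : Measure ℝ) [IsProbabilityMeasure μ] (p : ℝ[X]) :
    ∫ w, polyGauss p w ∂μ = -∫ t, polyGauss (stepPoly p) t * cdf μ t := by
  set q := stepPoly p
  have hset : MeasurableSet {z : ℝ × ℝ | z.1 ≤ z.2} := measurableSet_le measurable_fst measurable_snd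
  have hint : Integrable (Function.uncurry
      fun w t : ℝ => (Set.Ici w).indicator (polyGauss q) t) (μ.prod volume) := by
    have h := ((integrable_polyGauss q).comp_snd μ).indicator hset
    refine h.congr (ae_of_all _ fun z => ?_)
    simp [Set.indicator, Function.uncurry]
  -- integrate over `t ≥ w` first on one side, over `w ≤ t` first on the other
  have hswap := integral_integral_swap hint
  simp only [q, integral_indicator_Ici_polyGauss, integral_neg] at hswap
  rw [← neg_eq_iff_eq_neg, hswap]
  refine integral_congr_ae (ae_of_all _ fun t => ?_)
  have : (fun w : ℝ => (Set.Ici w).indicator (polyGauss (stepPoly p)) t)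
      = (Set.Iic t).indicator fun _ => polyGauss (stepPoly p) t := by
    ext w; simp [Set.indicator]
  simp only [this]
  rw [integral_indicator measurableSet_Iic, setIntegral_const, cdf_eq_real, smul_eq_mul, mul_comm]

theorem bddAbove_cdf_sub (μ ν : Measure ℝ) :
    BddAbove (Set.range fun x => |cdf μ x - cdf ν x|) := by
  refine ⟨1, ?_⟩
  rintro _ ⟨x, rfl⟩
  have h1 := cdf_nonneg μ x
  have h2 := cdf_le_one μ x
  have h3 := cdf_nonneg ν x
  have h4 := cdf_le_one ν x
  exact abs_le.2 ⟨by linarith, by linarith⟩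

theorem abs_cdf_sub_le_supDist (μ ν : Measure ℝ) (x : ℝ) :
    |cdf μ x - cdf ν x| ≤ supDist μ ν :=
  le_ciSup (bddAbove_cdf_sub μ ν) x

theorem supDist_nonneg (μ ν : Measure ℝ) : 0 ≤ supDist μ ν :=
  Real.iSup_nonneg fun _ => abs_nonneg _

/-- Expectations of `polyGauss p` under two laws differ by at most the sup-distance of the
distribution functions times the total variation of `polyGauss p`. -/
theorem abs_integral_polyGauss_sub_le (μ ν : Measure ℝ) [IsProbabilityMeasure μ]
    [IsProbabilityMeasure ν] (p : ℝ[X]) :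
    |∫ w, polyGauss p w ∂μ - ∫ w, polyGauss p w ∂ν|
      ≤ supDist μ ν * ∫ t, |polyGauss (stepPoly p) t| := by
  have hi (ρ : Measure ℝ) [IsProbabilityMeasure ρ] :
      Integrable fun t => polyGauss (stepPoly p) t * cdf ρ t := by
    refine (integrable_polyGauss _).mul_bdd (c := 1) (monotone_cdf ρ).measurable.aestronglyMeasurable
      (ae_of_all _ fun t => ?_)
    rw [Real.norm_eq_abs, abs_of_nonneg (cdf_nonneg ρ t)]
    exact cdf_le_one ρ t
  rw [integral_polyGauss_eq, integral_polyGauss_eq, neg_sub_neg, ← integral_sub (hi ν) (hi μ),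
    ← integral_const_mul]
  refine (abs_integral_le_integral_abs).trans (integral_mono_of_nonneg
    (ae_of_all _ fun _ => abs_nonneg _) ((integrable_polyGauss _).abs.const_mul _)
    (ae_of_all _ fun t => ?_))
  simp only
  rw [← mul_sub, abs_mul, mul_comm, abs_sub_comm]
  exact mul_le_mul_of_nonneg_right (abs_cdf_sub_le_supDist μ ν t) (abs_nonneg _)

theorem supDist_map_add_le (μ ν : Measure ℝ) [IsProbabilityMeasure μ]
    [IsProbabilityMeasure ν] (y : ℝ) :
    supDist (μ.map (· + y)) (ν.map (· + y)) ≤ supDist μ ν := by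
  have hm : Measurable fun w : ℝ => w + y := measurable_id.add_const y
  have h (ρ : Measure ℝ) [IsProbabilityMeasure ρ] (x : ℝ) :
      cdf (ρ.map (· + y)) x = cdf ρ (x - y) := by
    have := Measure.isProbabilityMeasure_map (μ := ρ) hm.aemeasurable
    rw [cdf_eq_real, cdf_eq_real, map_measureReal_apply hm measurableSet_Iic]
    congr 1
    ext w
    simp [le_sub_iff_add_le]
  refine ciSup_le fun x => ?_
  rw [h μ, h ν]
  exact abs_cdf_sub_le_supDist μ ν _

theorem abs_integral_polyGauss_add_sub_le (μ ν : Measure ℝ) [IsProbabilityMeasure μ]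
    [IsProbabilityMeasure ν] (p : ℝ[X]) (y : ℝ) :
    |∫ w, polyGauss p (w + y) ∂μ - ∫ w, polyGauss p (w + y) ∂ν|
      ≤ supDist μ ν * ∫ t, |polyGauss (stepPoly p) t| := by
  have hm : Measurable fun w : ℝ => w + y := measurable_id.add_const y
  have h1 := Measure.isProbabilityMeasure_map (μ := μ) hm.aemeasurable
  have h2 := Measure.isProbabilityMeasure_map (μ := ν) hm.aemeasurable
  have h := abs_integral_polyGauss_sub_le (μ.map (· + y)) (ν.map (· + y)) p
  rw [integral_map hm.aemeasurable (continuous_polyGauss p).aestronglyMeasurable,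
    integral_map hm.aemeasurable (continuous_polyGauss p).aestronglyMeasurable] at h
  exact h.trans (mul_le_mul_of_nonneg_right (supDist_map_add_le μ ν y)
    (integral_nonneg fun _ => abs_nonneg _))

/-- Second-order Taylor bound, with a constant depending on `p` only. -/
theorem exists_abs_polyGauss_taylor_le (p : ℝ[X]) :
    ∃ C, 0 ≤ C ∧ ∀ w t : ℝ,
      |polyGauss p (w + t) - polyGauss p w - t * polyGauss (stepPoly p) w| ≤ C * t ^ 2 := by
  obtain ⟨C, hC, h⟩ := exists_abs_polyGauss_le_const (stepPoly (stepPoly p))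
  refine ⟨C, hC, fun w t => ?_⟩
  have h1 (a b : ℝ) : |polyGauss (stepPoly p) b - polyGauss (stepPoly p) a| ≤ C * |b - a| :=
    convex_univ.norm_image_sub_le_of_norm_hasDerivWithin_le
      (fun x _ => (hasDerivAt_polyGauss (stepPoly p) x).hasDerivWithinAt) (fun x _ => h x)
      (Set.mem_univ a) (Set.mem_univ b)
  have h2 := (convex_uIcc (0 : ℝ) t).norm_image_sub_le_of_norm_hasDerivWithin_le
    (f := fun s => polyGauss p (w + s) - s * polyGauss (stepPoly p) w)
    (f' := fun s => polyGauss (stepPoly p) (w + s) - polyGauss (stepPoly p) w) (C := C * |t|)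
    (fun s _ => by
      have := ((hasDerivAt_polyGauss p (w + s)).comp_const_add w s).sub
        ((hasDerivAt_id s).mul_const (polyGauss (stepPoly p) w))
      rw [one_mul] at this
      exact this.hasDerivWithinAt)
    (fun s hs => by
      refine (h1 w (w + s)).trans (mul_le_mul_of_nonneg_left ?_ hC)
      rw [add_sub_cancel_left]
      simpa using Set.abs_sub_left_of_mem_uIcc hs)
    Set.left_mem_uIcc Set.right_mem_uIcc
  simp only [Real.norm_eq_abs, zero_mul, sub_zero, add_zero] at h2
  calc _ = |polyGauss p (w + t) - t * polyGauss (stepPoly p) w - polyGauss p w| := by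
        congr 1; ring
    _ ≤ C * |t| * |t| := h2
    _ = C * t ^ 2 := by rw [mul_assoc, abs_mul_abs_self, sq]

/-- The expectation of a translate may be differentiated under the integral sign. -/
theorem hasDerivAt_integral_polyGauss_add (μ : Measure ℝ) [IsProbabilityMeasure μ]
    (p : ℝ[X]) (y : ℝ) :
    HasDerivAt (fun y => ∫ w, polyGauss p (w + y) ∂μ)
      (∫ w, polyGauss (stepPoly p) (w + y) ∂μ) y := by
  obtain ⟨C, -, h⟩ := exists_abs_polyGauss_le_const p
  obtain ⟨C', -, h'⟩ := exists_abs_polyGauss_le_const (stepPoly p)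
  have hm (q : ℝ[X]) (y : ℝ) : AEStronglyMeasurable (fun w => polyGauss q (w + y)) μ :=
    ((continuous_polyGauss q).comp (continuous_id.add continuous_const)).aestronglyMeasurable
  exact (hasDerivAt_integral_of_dominated_loc_of_deriv_le (F := fun y w => polyGauss p (w + y))
    (F' := fun y w => polyGauss (stepPoly p) (w + y)) (bound := fun _ => C') Filter.univ_mem
    (Filter.Eventually.of_forall fun y => hm p y)
    (Integrable.of_bound (hm p y) C (ae_of_all _ fun w => h _)) (hm _ y)
    (ae_of_all _ fun w x _ => h' _) (integrable_const _)
    (ae_of_all _ fun w x _ => (hasDerivAt_polyGauss p (w + x)).comp_const_add w x)).2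

end PolyGauss

/-! ### Stein's method for sums of independent variables -/

section Stein

open Polynomial

/-- The expectation of `polyGauss p (w + y)` under `ν`, as a function of the shift `y`. -/
noncomputable def shiftMean (ν : Measure ℝ) (p : ℝ[X]) (y : ℝ) : ℝ :=
  ∫ w, polyGauss p (w + y) ∂ν

theorem hasDerivAt_shiftMean (ν : Measure ℝ) [IsProbabilityMeasure ν] (p : ℝ[X]) (y : ℝ) :
    HasDerivAt (shiftMean ν p) (shiftMean ν (stepPoly p) y) y :=
  hasDerivAt_integral_polyGauss_add ν p y

theorem continuous_shiftMean (ν : Measure ℝ) [IsProbabilityMeasure ν] (p : ℝ[X]) :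
    Continuous (shiftMean ν p) :=
  continuous_iff_continuousAt.2 fun y => (hasDerivAt_shiftMean ν p y).continuousAt

theorem exists_abs_shiftMean_le (p : ℝ[X]) :
    ∃ C, 0 ≤ C ∧ ∀ (ν : Measure ℝ) [IsProbabilityMeasure ν] (y : ℝ), |shiftMean ν p y| ≤ C := by
  obtain ⟨C, hC, h⟩ := exists_abs_polyGauss_le_const p
  refine ⟨C, hC, fun ν _ y => ?_⟩
  have := norm_integral_le_of_norm_le_const (μ := ν) (f := fun w => polyGauss p (w + y))
    (ae_of_all _ fun w => h _)
  simpa [shiftMean] using this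

variable {Ω : Type*} [MeasurableSpace Ω] {P : Measure Ω} {X Y : Ω → ℝ}

theorem integrable_polyGauss_comp [IsProbabilityMeasure P] (p : ℝ[X]) (hY : Measurable Y) :
    Integrable (fun ω => polyGauss p (Y ω)) P := by
  obtain ⟨C, -, h⟩ := exists_abs_polyGauss_le_const p
  exact Integrable.of_bound ((continuous_polyGauss p).measurable.comp hY).aestronglyMeasurable C
    (ae_of_all _ fun w => h _)

theorem integrable_mul_polyGauss_comp (p : ℝ[X]) (hX : Integrable X P) (hY : Measurable Y) :
    Integrable (fun ω => X ω * polyGauss p (Y ω)) P := by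
  obtain ⟨C, -, h⟩ := exists_abs_polyGauss_le_const p
  exact hX.mul_bdd (c := C) ((continuous_polyGauss p).measurable.comp hY).aestronglyMeasurable
    (ae_of_all _ fun w => h _)

theorem shiftMean_map (p : ℝ[X]) (hY : Measurable Y) (y : ℝ) :
    shiftMean (P.map Y) p y = ∫ ω, polyGauss p (Y ω + y) ∂P := by
  rw [shiftMean, integral_map hY.aemeasurable]
  exact ((continuous_polyGauss p).comp (continuous_id.add continuous_const)).aestronglyMeasurable

/-- Adding an independent centred variable changes the expectation by `O(E X²)` only. -/
theorem exists_abs_shiftMean_map_add_sub_le (p : ℝ[X]) :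
    ∃ C, 0 ≤ C ∧ ∀ {Ω : Type} [MeasurableSpace Ω] (P : Measure Ω) [IsProbabilityMeasure P]
      {X Y : Ω → ℝ}, Measurable X → Measurable Y → IndepFun X Y P → MemLp X 2 P →
      ∫ ω, X ω ∂P = 0 → ∀ y,
      |shiftMean (P.map (Y + X)) p y - shiftMean (P.map Y) p y| ≤ C * ∫ ω, X ω ^ 2 ∂P := by
  obtain ⟨C, hC, h⟩ := exists_abs_polyGauss_taylor_le p
  refine ⟨C, hC, fun P _ X Y hX hY hXY hX2 hX0 y => ?_⟩
  have hXi : Integrable X P := hX2.integrable (by norm_num)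
  have hmix : ∫ ω, X ω * polyGauss (stepPoly p) (Y ω + y) ∂P = 0 := by
    have hg : Measurable fun w : ℝ => polyGauss (stepPoly p) (w + y) :=
      (continuous_polyGauss _).measurable.comp (measurable_id.add_const y)
    have := (hXY.comp measurable_id hg).integral_fun_mul_eq_mul_integral
      hX.aestronglyMeasurable (hg.comp hY).aestronglyMeasurable
    simp only [Function.comp_apply, id] at this
    rw [this, hX0, zero_mul]
  have hi1 : Integrable (fun ω => polyGauss p (Y ω + y + X ω)) P :=
    integrable_polyGauss_comp p ((hY.add_const y).add hX)
  have hi2 : Integrable (fun ω => polyGauss p (Y ω + y)) P :=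
    integrable_polyGauss_comp p (hY.add_const y)
  have hi3 : Integrable (fun ω => X ω * polyGauss (stepPoly p) (Y ω + y)) P :=
    integrable_mul_polyGauss_comp _ hXi (hY.add_const y)
  have hi4 : Integrable (fun ω => polyGauss p (Y ω + y + X ω) - polyGauss p (Y ω + y)) P :=
    hi1.sub hi2
  -- the first-order term is free, because `X` is centred and independent of `Y`
  have key : shiftMean (P.map (Y + X)) p y - shiftMean (P.map Y) p y
      = ∫ ω, (polyGauss p (Y ω + y + X ω) - polyGauss p (Y ω + y)
          - X ω * polyGauss (stepPoly p) (Y ω + y)) ∂P := by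
    rw [shiftMean_map p hY, shiftMean_map p (hY.add hX), integral_sub hi4 hi3, hmix,
      integral_sub hi1 hi2, sub_zero]
    simp only [Pi.add_apply, add_right_comm]
  rw [key, ← integral_const_mul]
  exact abs_integral_le_integral_abs.trans (integral_mono_of_nonneg
    (ae_of_all _ fun _ => abs_nonneg _) (hX2.integrable_sq.const_mul C)
    (ae_of_all _ fun ω => h _ _))

theorem integral_mul_polyGauss_add_eq [IsProbabilityMeasure P] (p : ℝ[X])
    (hX : Measurable X) (hY : Measurable Y)
    (hXY : IndepFun X Y P) (hXi : Integrable X P) :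
    ∫ ω, X ω * polyGauss p (Y ω + X ω) ∂P = ∫ ω, X ω * shiftMean (P.map Y) p (X ω) ∂P := by
  have hXP := Measure.isProbabilityMeasure_map (μ := P) hX.aemeasurable
  have hYP := Measure.isProbabilityMeasure_map (μ := P) hY.aemeasurable
  have hmap := (indepFun_iff_map_prod_eq_prod_map_map hX.aemeasurable hY.aemeasurable).1 hXY
  have hF : Continuous fun z : ℝ × ℝ => z.1 * polyGauss p (z.2 + z.1) :=
    continuous_fst.mul ((continuous_polyGauss p).comp (continuous_snd.add continuous_fst))
  have hint : Integrable (fun z : ℝ × ℝ => z.1 * polyGauss p (z.2 + z.1))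
      ((P.map X).prod (P.map Y)) := by
    rw [← hmap, integrable_map_measure hF.aestronglyMeasurable (hX.prodMk hY).aemeasurable]
    exact integrable_mul_polyGauss_comp p hXi (hY.add hX)
  calc ∫ ω, X ω * polyGauss p (Y ω + X ω) ∂P
      = ∫ z, z.1 * polyGauss p (z.2 + z.1) ∂((P.map X).prod (P.map Y)) := by
        rw [← hmap, integral_map (hX.prodMk hY).aemeasurable hF.aestronglyMeasurable]
    _ = ∫ x, x * shiftMean (P.map Y) p x ∂(P.map X) := by
        rw [integral_prod _ hint]
        simp only [integral_const_mul, shiftMean]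
    _ = _ := by
        rw [integral_map hX.aemeasurable]
        exact (continuous_id.mul (continuous_shiftMean _ p)).aestronglyMeasurable

/-- One summand `X` of a sum `Y + X` of independent variables: in the Stein term
`E[X f(Y + X)]` the law of `Y` may be replaced by any law `ν` close to that of `Y + X`. The two
functions `y ↦ E f(Y + y)` and `y ↦ ∫ f(w + y) dν` have uniformly close derivatives, so their
increments from `0` to `X` are close relative to `|X|`. -/
theorem exists_abs_stein_term_sub_le (p : ℝ[X]) :
    ∃ C, 0 ≤ C ∧ ∀ {Ω : Type} [MeasurableSpace Ω] (P : Measure Ω) [IsProbabilityMeasure P]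
      (ν : Measure ℝ) [IsProbabilityMeasure ν]
      {X Y : Ω → ℝ}, Measurable X → Measurable Y → IndepFun X Y P → MemLp X 2 P →
      ∫ ω, X ω ∂P = 0 →
      |∫ ω, X ω * polyGauss p (Y ω + X ω) ∂P
          - ∫ ω, X ω * (shiftMean ν p (X ω) - shiftMean ν p 0) ∂P|
        ≤ C * (supDist (P.map (Y + X)) ν + ∫ ω, X ω ^ 2 ∂P) * ∫ ω, X ω ^ 2 ∂P := by
  obtain ⟨C, hC, h⟩ := exists_abs_shiftMean_map_add_sub_le (stepPoly p)
  set L := ∫ t, |polyGauss (stepPoly (stepPoly p)) t| with hL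
  have hL0 : 0 ≤ L := integral_nonneg fun _ => abs_nonneg _
  refine ⟨C + L, by positivity, fun P _ ν _ X Y hX hY hXY hX2 hX0 => ?_⟩
  have hYP := Measure.isProbabilityMeasure_map (μ := P) hY.aemeasurable
  have hYXP := Measure.isProbabilityMeasure_map (μ := P) (hY.add hX).aemeasurable
  have hXi : Integrable X P := hX2.integrable (by norm_num)
  set μ := P.map Y
  set s := ∫ ω, X ω ^ 2 ∂P with hs
  set Δ := supDist (P.map (Y + X)) ν with hΔ
  have hs0 : 0 ≤ s := integral_nonneg fun _ => sq_nonneg _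
  have hΔ0 : 0 ≤ Δ := supDist_nonneg _ _
  set ε := (C + L) * (Δ + s) with hε
  have hder (y : ℝ) : |shiftMean μ (stepPoly p) y - shiftMean ν (stepPoly p) y| ≤ ε := by
    have h1 := h P hX hY hXY hX2 hX0 y
    have h2 := abs_integral_polyGauss_add_sub_le (P.map (Y + X)) ν (stepPoly p) y
    rw [abs_sub_comm] at h1
    calc _ ≤ C * s + Δ * L := (abs_sub_le _ _ _).trans (add_le_add h1 h2)
      _ ≤ ε := by rw [hε]; nlinarith [mul_nonneg hC hΔ0, mul_nonneg hL0 hs0]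
  have hinc (x : ℝ) : |(shiftMean μ p x - shiftMean ν p x) - (shiftMean μ p 0 - shiftMean ν p 0)|
      ≤ ε * |x| := by
    have := convex_univ.norm_image_sub_le_of_norm_hasDerivWithin_le
      (f := fun y => shiftMean μ p y - shiftMean ν p y)
      (fun y _ => ((hasDerivAt_shiftMean μ p y).sub (hasDerivAt_shiftMean ν p y)).hasDerivWithinAt)
      (fun y _ => hder y) (Set.mem_univ 0) (Set.mem_univ x)
    simpa using this
  obtain ⟨B, -, hB⟩ := exists_abs_shiftMean_le p
  have hi (ρ : Measure ℝ) [IsProbabilityMeasure ρ] :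
      Integrable (fun ω => X ω * shiftMean ρ p (X ω)) P :=
    hXi.mul_bdd (c := B) ((continuous_shiftMean ρ p).measurable.comp hX).aestronglyMeasurable
      (ae_of_all _ fun ω => hB ρ _)
  have hi' : Integrable (fun ω => X ω * shiftMean μ p (X ω) - X ω * shiftMean ν p (X ω)) P :=
    (hi μ).sub (hi ν)
  have hi0 : Integrable (fun ω => X ω * shiftMean μ p 0 - X ω * shiftMean ν p 0) P :=
    (hXi.mul_const _).sub (hXi.mul_const _)
  -- the constants `shiftMean _ p 0` cost nothing, because `X` is centred
  have key : ∫ ω, X ω * polyGauss p (Y ω + X ω) ∂P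
        - ∫ ω, X ω * (shiftMean ν p (X ω) - shiftMean ν p 0) ∂P
      = ∫ ω, X ω * ((shiftMean μ p (X ω) - shiftMean ν p (X ω))
          - (shiftMean μ p 0 - shiftMean ν p 0)) ∂P := by
    rw [integral_mul_polyGauss_add_eq p hX hY hXY hXi]
    simp only [mul_sub]
    rw [integral_sub (hi ν) (hXi.mul_const _), integral_sub hi' hi0, integral_sub (hi μ) (hi ν),
      integral_sub (hXi.mul_const _) (hXi.mul_const _)]
    simp only [integral_mul_const, hX0]
    ring
  rw [key, ← integral_const_mul]
  refine abs_integral_le_integral_abs.trans (integral_mono_of_nonneg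
    (ae_of_all _ fun _ => abs_nonneg _) (hX2.integrable_sq.const_mul ε)
    (ae_of_all _ fun ω => ?_))
  simp only
  rw [abs_mul]
  calc _ ≤ |X ω| * (ε * |X ω|) := mul_le_mul_of_nonneg_left (hinc _) (abs_nonneg _)
    _ = ε * X ω ^ 2 := by rw [← sq_abs (X ω)]; ring

theorem polyGauss_X_mul (p : ℝ[X]) (w : ℝ) :
    polyGauss (Polynomial.X * p) w = w * polyGauss p w := by
  simp [polyGauss, mul_assoc]

/-- Stein's method for a sum of independent centred variables with total variance one. The
second-order remainders of `u(y) = E f(N + y)`, where `N` is standard normal and satisfies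
`E[N f(N)] = u'(0)`, are controlled by the distance of the sum from normality. -/
theorem exists_abs_sum_remainder_le (ν : Measure ℝ) [IsProbabilityMeasure ν] (p : ℝ[X])
    (hν : ∫ w, w * polyGauss p w ∂ν = shiftMean ν (stepPoly p) 0) :
    ∃ C, 0 ≤ C ∧ ∀ (Ω : Type) [MeasurableSpace Ω] (P : Measure Ω) [IsProbabilityMeasure P]
      (m : ℕ) (X : Fin m → Ω → ℝ),
      (∀ i, Measurable (X i)) → iIndepFun X P → (∀ i, MemLp (X i) 2 P) →
      (∀ i, ∫ ω, X i ω ∂P = 0) → (∑ i, ∫ ω, X i ω ^ 2 ∂P = 1) →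
      |∑ i, ∫ ω, X i ω * (shiftMean ν p (X i ω) - shiftMean ν p 0
          - X i ω * shiftMean ν (stepPoly p) 0) ∂P|
        ≤ C * (supDist (P.map fun ω => ∑ i, X i ω) ν
          + ∑ i, (∫ ω, X i ω ^ 2 ∂P) ^ 2) := by
  obtain ⟨C, hC, h⟩ := exists_abs_stein_term_sub_le p
  set L := ∫ t, |polyGauss (stepPoly (Polynomial.X * p)) t| with hL
  have hL0 : 0 ≤ L := integral_nonneg fun _ => abs_nonneg _
  refine ⟨C + L, by positivity, fun Ω _ P _ m X hX hind hX2 hX0 hsum => ?_⟩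
  set W : Ω → ℝ := fun ω => ∑ i, X i ω with hW
  have hWm : Measurable W := Finset.measurable_sum _ fun i _ => hX i
  have hWP := Measure.isProbabilityMeasure_map (μ := P) hWm.aemeasurable
  set Δ := supDist (P.map W) ν with hΔ
  have hΔ0 : 0 ≤ Δ := supDist_nonneg _ _
  have hXi (i) : Integrable (X i) P := (hX2 i).integrable (by norm_num)
  -- the summand `X i` against the sum of the others
  have hterm (i : Fin m) : |∫ ω, X i ω * polyGauss p (W ω) ∂P
        - ∫ ω, X i ω * (shiftMean ν p (X i ω) - shiftMean ν p 0) ∂P|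
      ≤ C * (Δ + ∫ ω, X i ω ^ 2 ∂P) * ∫ ω, X i ω ^ 2 ∂P := by
    have hYm : Measurable (∑ j ∈ Finset.univ.erase i, X j) :=
      by fun_prop
    have hYX : (∑ j ∈ Finset.univ.erase i, X j) + X i = W := by
      rw [Finset.sum_erase_add _ _ (Finset.mem_univ i)]
      ext ω
      simp [hW]
    have := h P ν (hX i) hYm
      (hind.indepFun_finsetSum_of_notMem hX (Finset.notMem_erase i _)).symm (hX2 i) (hX0 i)
    rw [hYX] at this
    have hpt (ω : Ω) : (∑ j ∈ Finset.univ.erase i, X j) ω + X i ω = W ω := congrFun hYX ω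
    simpa only [hpt] using this
  -- the sum of the Stein terms is `E[W f(W)]`, and `w f(w)` is again in the class
  have hW0 : |∑ i, ∫ ω, X i ω * polyGauss p (W ω) ∂P - shiftMean ν (stepPoly p) 0| ≤ Δ * L := by
    have := abs_integral_polyGauss_sub_le (P.map W) ν (Polynomial.X * p)
    simp only [polyGauss_X_mul, hν] at this
    have hc : Continuous fun w => w * polyGauss p w := continuous_id.mul (continuous_polyGauss p)
    rw [integral_map hWm.aemeasurable hc.aestronglyMeasurable] at this
    rwa [← integral_finsetSum _ fun i _ => integrable_mul_polyGauss_comp p (hXi i) hWm,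
      show (fun ω => ∑ i, X i ω * polyGauss p (W ω)) = fun ω => W ω * polyGauss p (W ω) from
        funext fun ω => by rw [← Finset.sum_mul]]
  obtain ⟨B, -, hB⟩ := exists_abs_shiftMean_le p
  have hsplit (i : Fin m) : ∫ ω, X i ω * (shiftMean ν p (X i ω) - shiftMean ν p 0
        - X i ω * shiftMean ν (stepPoly p) 0) ∂P
      = ∫ ω, X i ω * (shiftMean ν p (X i ω) - shiftMean ν p 0) ∂P
        - (∫ ω, X i ω ^ 2 ∂P) * shiftMean ν (stepPoly p) 0 := by
    have hi : Integrable (fun ω => X i ω * (shiftMean ν p (X i ω) - shiftMean ν p 0)) P :=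
      (hXi i).mul_bdd (c := B + B)
        (((continuous_shiftMean ν p).measurable.comp (hX i)).sub_const _).aestronglyMeasurable
        (ae_of_all _ fun ω => (abs_sub _ _).trans (add_le_add (hB ν _) (hB ν _)))
    rw [← integral_mul_const, ← integral_sub hi ((hX2 i).integrable_sq.mul_const _)]
    congr 1 with ω
    ring
  have hall : |∑ i, ∫ ω, X i ω * polyGauss p (W ω) ∂P
        - ∑ i, ∫ ω, X i ω * (shiftMean ν p (X i ω) - shiftMean ν p 0) ∂P|
      ≤ C * (Δ + ∑ i, (∫ ω, X i ω ^ 2 ∂P) ^ 2) := by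
    rw [← Finset.sum_sub_distrib]
    calc _ ≤ ∑ i, C * (Δ + ∫ ω, X i ω ^ 2 ∂P) * ∫ ω, X i ω ^ 2 ∂P :=
          (Finset.abs_sum_le_sum_abs _ _).trans (Finset.sum_le_sum fun i _ => hterm i)
      _ = C * (Δ * ∑ i, ∫ ω, X i ω ^ 2 ∂P + ∑ i, (∫ ω, X i ω ^ 2 ∂P) ^ 2) := by
          rw [Finset.mul_sum, ← Finset.sum_add_distrib, Finset.mul_sum]
          exact Finset.sum_congr rfl fun i _ => by ring
      _ = _ := by rw [hsum, mul_one]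
  rw [Finset.sum_congr rfl fun i _ => hsplit i, Finset.sum_sub_distrib, ← Finset.sum_mul, hsum,
    one_mul]
  have hQ : 0 ≤ ∑ i, (∫ ω, X i ω ^ 2 ∂P) ^ 2 := Finset.sum_nonneg fun _ _ => sq_nonneg _
  rw [abs_sub_comm] at hall
  refine (abs_sub_le _ _ _).trans ((add_le_add hall hW0).trans ?_)
  nlinarith [mul_nonneg hL0 hQ]

end Stein

/-! ### The reversed Berry–Esseen inequality -/

section GaussianShift

open Polynomial

theorem shiftMean_gaussian_one (y : ℝ) :
    shiftMean (gaussianReal 0 1) 1 y = (√2)⁻¹ * Real.exp (-(y ^ 2 / 4)) := by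
  rw [shiftMean, integral_gaussianReal_eq_integral_smul one_ne_zero]
  have h (x : ℝ) : gaussianPDFReal 0 1 x • polyGauss 1 (x + y)
      = (√(2 * Real.pi))⁻¹ * Real.exp (-(y ^ 2 / 4)) * Real.exp (-1 * (x + y / 2) ^ 2) := by
    simp only [gaussianPDFReal, polyGauss, eval_one, smul_eq_mul, NNReal.coe_one, mul_one, one_mul,
      sub_zero]
    rw [mul_assoc, mul_assoc, ← Real.exp_add, ← Real.exp_add]
    ring_nf
  simp only [h]
  rw [integral_const_mul, integral_add_right_eq_self (fun x : ℝ => Real.exp (-1 * x ^ 2)) (y / 2),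
    integral_gaussian, div_one, Real.sqrt_mul (by norm_num)]
  have := Real.sqrt_pos.2 Real.pi_pos
  field_simp

theorem stepPoly_one : stepPoly 1 = -X := by simp [stepPoly]

theorem stepPoly_X : stepPoly X = 1 - X * X := by simp [stepPoly]

theorem hasDerivAt_exp_neg_sq_div_four (y : ℝ) :
    HasDerivAt (fun y : ℝ => Real.exp (-(y ^ 2 / 4)))
      (-(y / 2) * Real.exp (-(y ^ 2 / 4))) y := by
  have h1 : HasDerivAt (fun y : ℝ => -(y ^ 2 / 4)) (-(y / 2)) y := by
    convert! ((hasDerivAt_pow 2 y).div_const 4).neg using 1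
    simp only [Nat.cast_ofNat]
    ring
  convert! h1.exp using 1
  ring

theorem shiftMean_neg (ν : Measure ℝ) (p : ℝ[X]) (y : ℝ) :
    shiftMean ν (-p) y = -shiftMean ν p y := by
  simp only [shiftMean, polyGauss, eval_neg, neg_mul, integral_neg]

/-- By differentiating `shiftMean_gaussian_one`. -/
theorem shiftMean_gaussian_X (y : ℝ) :
    shiftMean (gaussianReal 0 1) X y = (√2)⁻¹ * (y / 2 * Real.exp (-(y ^ 2 / 4))) := by
  have h1 := hasDerivAt_shiftMean (gaussianReal 0 1) 1 y
  rw [show shiftMean (gaussianReal 0 1) 1 = _ from funext shiftMean_gaussian_one, stepPoly_one]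
    at h1
  have h2 := h1.unique ((hasDerivAt_exp_neg_sq_div_four y).const_mul _)
  rw [shiftMean_neg] at h2
  linarith

theorem shiftMean_gaussian_stepPoly_one_zero :
    shiftMean (gaussianReal 0 1) (stepPoly 1) 0 = 0 := by
  rw [stepPoly_one, shiftMean_neg, shiftMean_gaussian_X]
  simp

/-- By differentiating `shiftMean_gaussian_X`. -/
theorem shiftMean_gaussian_stepPoly_X_zero :
    shiftMean (gaussianReal 0 1) (stepPoly X) 0 = (√2)⁻¹ / 2 := by
  have h1 := hasDerivAt_shiftMean (gaussianReal 0 1) X 0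
  rw [show shiftMean (gaussianReal 0 1) X = _ from funext shiftMean_gaussian_X] at h1
  have h2 := h1.unique ((((hasDerivAt_id (0 : ℝ)).div_const 2).mul
    (hasDerivAt_exp_neg_sq_div_four 0)).const_mul _)
  rw [h2]
  simp [div_eq_mul_inv]

/-- `E[N f(N)] = E f'(N)` for `f(x) = e^{-x²/2}`. -/
theorem integral_mul_polyGauss_one_gaussian :
    ∫ w, w * polyGauss 1 w ∂(gaussianReal 0 1)
      = shiftMean (gaussianReal 0 1) (stepPoly 1) 0 := by
  have h : ∫ w, w * polyGauss 1 w ∂(gaussianReal 0 1) = shiftMean (gaussianReal 0 1) X 0 := by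
    simp [shiftMean, polyGauss]
  rw [h, shiftMean_gaussian_stepPoly_one_zero, shiftMean_gaussian_X]
  simp

/-- `E[N f(N)] = E f'(N)` for `f(x) = x e^{-x²/2}`. -/
theorem integral_mul_polyGauss_X_gaussian :
    ∫ w, w * polyGauss X w ∂(gaussianReal 0 1)
      = shiftMean (gaussianReal 0 1) (stepPoly X) 0 := by
  -- `w² = 1 - (1 - w²)`, and `1 - X²` is `stepPoly X`
  have h : ∫ w, w * polyGauss X w ∂(gaussianReal 0 1)
      = shiftMean (gaussianReal 0 1) 1 0 - shiftMean (gaussianReal 0 1) (stepPoly X) 0 := by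
    rw [shiftMean, shiftMean, ← integral_sub]
    · congr 1 with w
      simp only [polyGauss, stepPoly_X, eval_X, eval_sub, eval_mul, eval_one, add_zero]
      ring
    · exact integrable_polyGauss_comp _ (measurable_id.add_const 0)
    · exact integrable_polyGauss_comp _ (measurable_id.add_const 0)
  rw [h, shiftMean_gaussian_stepPoly_X_zero, shiftMean_gaussian_one]
  simp
  ring

end GaussianShift

section Truncation

/-- The truncated moment `x² 1{|x| > 1} + x⁴ 1{|x| ≤ 1}`. -/
noncomputable def truncMoment (x : ℝ) : ℝ :=
  {x : ℝ | 1 < |x|}.indicator (fun x => x ^ 2) x + {x : ℝ | |x| ≤ 1}.indicator (fun x => x ^ 4) x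

theorem truncMoment_of_le {x : ℝ} (h : |x| ≤ 1) : truncMoment x = x ^ 4 := by
  simp [truncMoment, h, h.not_gt]

theorem truncMoment_of_lt {x : ℝ} (h : 1 < |x|) : truncMoment x = x ^ 2 := by
  simp [truncMoment, h, h.not_ge]

/-- The remainder of `x e^{-x²/2}` dominates the truncated moment. -/
theorem truncMoment_le (x : ℝ) :
    truncMoment x ≤ 8 * (x ^ 2 * (1 - Real.exp (-(x ^ 2 / 4)))) := by
  have hx := sq_nonneg x
  rcases le_or_gt |x| 1 with h | h
  · have h1 : x ^ 2 ≤ 1 := (sq_le_one_iff_abs_le_one x).2 h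
    have h2 := (abs_le.1 (Real.abs_exp_sub_one_sub_id_le (x := -(x ^ 2 / 4))
      (by rw [abs_neg, abs_of_nonneg (by positivity)]; linarith))).2
    rw [truncMoment_of_le h]
    nlinarith
  · have h1 : 1 < x ^ 2 := (one_lt_sq_iff_one_lt_abs x).2 h
    have h2 := Real.add_one_le_exp (x ^ 2 / 4)
    have h3 : Real.exp (-(x ^ 2 / 4)) ≤ 4 / 5 := by
      rw [Real.exp_neg]
      exact inv_le_of_inv_le₀ (by norm_num) (by norm_num; linarith)
    rw [truncMoment_of_lt h]
    nlinarith

/-- The remainder of `e^{-x²/2}` recovers the truncated cube, up to the truncated moment. -/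
theorem abs_truncated_cube_sub_le (x : ℝ) :
    |{x : ℝ | |x| ≤ 1}.indicator (fun x => x ^ 3) x - 4 * (x * (1 - Real.exp (-(x ^ 2 / 4))))|
      ≤ 4 * truncMoment x := by
  have hx := sq_nonneg x
  rcases le_or_gt |x| 1 with h | h
  · have h1 : x ^ 2 ≤ 1 := (sq_le_one_iff_abs_le_one x).2 h
    have h2 := Real.abs_exp_sub_one_sub_id_le (x := -(x ^ 2 / 4))
      (by rw [abs_neg, abs_of_nonneg (by positivity)]; linarith)
    rw [truncMoment_of_le h, Set.indicator_of_mem (by exact h)]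
    have h3 : x ^ 3 - 4 * (x * (1 - Real.exp (-(x ^ 2 / 4))))
        = 4 * (x * (Real.exp (-(x ^ 2 / 4)) - 1 - -(x ^ 2 / 4))) := by ring
    rw [h3, abs_mul, abs_mul, abs_of_pos (by norm_num : (0 : ℝ) < 4)]
    have h4 := mul_le_mul h h2 (abs_nonneg _) zero_le_one
    nlinarith [sq_nonneg (x ^ 2)]
  · have h1 : |x| ≤ x ^ 2 := by rw [← sq_abs]; nlinarith
    have h2 : 0 ≤ 1 - Real.exp (-(x ^ 2 / 4)) :=
      sub_nonneg.2 (Real.exp_le_one_iff.2 (by linarith))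
    have h3 : 1 - Real.exp (-(x ^ 2 / 4)) ≤ 1 := by linarith [Real.exp_pos (-(x ^ 2 / 4))]
    rw [truncMoment_of_lt h, Set.indicator_of_notMem (by simpa using h), zero_sub, abs_neg,
      abs_mul, abs_mul, abs_of_nonneg h2, abs_of_pos (by norm_num : (0 : ℝ) < 4)]
    nlinarith [abs_nonneg x]

variable {Ω : Type*} [MeasurableSpace Ω] {P : Measure Ω} {X : Ω → ℝ}

theorem measurableSet_abs_le_one : MeasurableSet {x : ℝ | |x| ≤ 1} :=
  measurableSet_le measurable_id.abs measurable_const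

theorem measurableSet_one_lt_abs : MeasurableSet {x : ℝ | 1 < |x|} :=
  measurableSet_lt measurable_const measurable_id.abs

theorem integrable_truncated_pow [IsProbabilityMeasure P] (hX : Measurable X) (k : ℕ) :
    Integrable (fun ω => {x : ℝ | |x| ≤ 1}.indicator (fun x => x ^ k) (X ω)) P := by
  refine Integrable.of_bound (((measurable_id.pow_const k).indicator
    measurableSet_abs_le_one).comp hX).aestronglyMeasurable 1 (ae_of_all _ fun ω => ?_)
  by_cases h : |X ω| ≤ 1
  · rw [Set.indicator_of_mem (by exact h), norm_pow]
    exact pow_le_one₀ (norm_nonneg _) h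
  · rw [Set.indicator_of_notMem (by exact h)]
    simp

theorem integrable_sq_indicator (hX : Measurable X) (hX2 : MemLp X 2 P) :
    Integrable (fun ω => {x : ℝ | 1 < |x|}.indicator (fun x => x ^ 2) (X ω)) P :=
  hX2.integrable_sq.indicator (hX measurableSet_one_lt_abs)

theorem integral_truncMoment [IsProbabilityMeasure P] (hX : Measurable X) (hX2 : MemLp X 2 P) :
    ∫ ω, truncMoment (X ω) ∂P
      = (∫ ω in {ω | 1 < |X ω|}, X ω ^ 2 ∂P) + ∫ ω in {ω | |X ω| ≤ 1}, X ω ^ 4 ∂P := by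
  rw [← integral_indicator (s := {ω | 1 < |X ω|}) (hX measurableSet_one_lt_abs),
    ← integral_indicator (s := {ω | |X ω| ≤ 1}) (hX measurableSet_abs_le_one)]
  exact integral_add (integrable_sq_indicator hX hX2) (integrable_truncated_pow hX 4)

theorem integrable_truncMoment [IsProbabilityMeasure P] (hX : Measurable X)
    (hX2 : MemLp X 2 P) : Integrable (fun ω => truncMoment (X ω)) P :=
  (integrable_sq_indicator hX hX2).add (integrable_truncated_pow hX 4)

theorem integrable_mul_one_sub_exp {Y : Ω → ℝ} (hX : Measurable X) (hY : Integrable Y P) :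
    Integrable (fun ω => Y ω * (1 - Real.exp (-(X ω ^ 2 / 4)))) P := by
  refine hY.mul_bdd (c := 1) (by fun_prop) (ae_of_all _ fun ω => ?_)
  have h1 := Real.exp_pos (-(X ω ^ 2 / 4))
  have h2 : Real.exp (-(X ω ^ 2 / 4)) ≤ 1 :=
    Real.exp_le_one_iff.2 (by linarith [sq_nonneg (X ω)])
  rw [Real.norm_eq_abs, abs_of_nonneg (by linarith)]
  linarith

theorem integral_truncMoment_le [IsProbabilityMeasure P] (hX : Measurable X)
    (hX2 : MemLp X 2 P) :
    ∫ ω, truncMoment (X ω) ∂P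
      ≤ 8 * ∫ ω, X ω ^ 2 * (1 - Real.exp (-(X ω ^ 2 / 4))) ∂P := by
  rw [← integral_const_mul]
  exact integral_mono (integrable_truncMoment hX hX2)
    ((integrable_mul_one_sub_exp hX hX2.integrable_sq).const_mul 8) fun ω => truncMoment_le _

theorem abs_integral_truncated_cube_sub_le [IsProbabilityMeasure P] (hX : Measurable X)
    (hX2 : MemLp X 2 P) :
    |(∫ ω in {ω | |X ω| ≤ 1}, X ω ^ 3 ∂P)
        - 4 * ∫ ω, X ω * (1 - Real.exp (-(X ω ^ 2 / 4))) ∂P|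
      ≤ 4 * ∫ ω, truncMoment (X ω) ∂P := by
  have h1 : ∫ ω in {ω | |X ω| ≤ 1}, X ω ^ 3 ∂P
      = ∫ ω, {x : ℝ | |x| ≤ 1}.indicator (fun x => x ^ 3) (X ω) ∂P := by
    rw [← integral_indicator (s := {ω | |X ω| ≤ 1}) (hX measurableSet_abs_le_one)]
    rfl
  have hi := integrable_mul_one_sub_exp hX (hX2.integrable (by norm_num))
  rw [h1, ← integral_const_mul, ← integral_const_mul,
    ← integral_sub (integrable_truncated_pow hX 3) (hi.const_mul 4)]
  exact abs_integral_le_integral_abs.trans (integral_mono_of_nonneg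
    (ae_of_all _ fun _ => abs_nonneg _) ((integrable_truncMoment hX hX2).const_mul 4)
    (ae_of_all _ fun ω => abs_truncated_cube_sub_le _))

/-- The reversed Berry–Esseen inequality. -/
theorem exists_isHallBarbourConstant : ∃ D : ℝ, IsHallBarbourConstant D := by
  obtain ⟨C₁, hC₁, h₁⟩ := exists_abs_sum_remainder_le (gaussianReal 0 1) Polynomial.X
    integral_mul_polyGauss_X_gaussian
  obtain ⟨C₂, hC₂, h₂⟩ := exists_abs_sum_remainder_le (gaussianReal 0 1) 1
    integral_mul_polyGauss_one_gaussian
  refine ⟨80 * √2 * C₁ + 4 * √2 * C₂ + 1, by positivity,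
    fun Ω _ P _ m Y hY hind hY2 hY0 _ hsum => ?_⟩
  have e₁ := h₁ Ω P m Y hY hind hY2 hY0 hsum
  have e₂ := h₂ Ω P m Y hY hind hY2 hY0 hsum
  set R := supDist (P.map fun ω => ∑ i, Y i ω) (gaussianReal 0 1)
    + ∑ i, (∫ ω, Y i ω ^ 2 ∂P) ^ 2
  have hR : 0 ≤ R := add_nonneg (supDist_nonneg _ _) (Finset.sum_nonneg fun _ _ => sq_nonneg _)
  set S := ∑ i, ∫ ω, Y i ω ^ 2 * (1 - Real.exp (-(Y i ω ^ 2 / 4))) ∂P with hS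
  set T := ∑ i, ∫ ω, Y i ω * (1 - Real.exp (-(Y i ω ^ 2 / 4))) ∂P with hT
  have i₁ (i) (ω : Ω) : Y i ω * (shiftMean (gaussianReal 0 1) Polynomial.X (Y i ω)
        - shiftMean (gaussianReal 0 1) Polynomial.X 0
        - Y i ω * shiftMean (gaussianReal 0 1) (stepPoly Polynomial.X) 0)
      = -((√2)⁻¹ / 2) * (Y i ω ^ 2 * (1 - Real.exp (-(Y i ω ^ 2 / 4)))) := by
    rw [shiftMean_gaussian_X, shiftMean_gaussian_X, shiftMean_gaussian_stepPoly_X_zero]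
    ring
  have i₂ (i) (ω : Ω) : Y i ω * (shiftMean (gaussianReal 0 1) 1 (Y i ω)
        - shiftMean (gaussianReal 0 1) 1 0
        - Y i ω * shiftMean (gaussianReal 0 1) (stepPoly 1) 0)
      = -(√2)⁻¹ * (Y i ω * (1 - Real.exp (-(Y i ω ^ 2 / 4)))) := by
    rw [shiftMean_gaussian_one, shiftMean_gaussian_one, shiftMean_gaussian_stepPoly_one_zero]
    norm_num
    ring
  simp only [i₁, integral_const_mul, ← Finset.mul_sum, ← hS] at e₁
  simp only [i₂, integral_const_mul, ← Finset.mul_sum, ← hT] at e₂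
  have h2 : (0 : ℝ) < √2 := by positivity
  have hSle : S ≤ 2 * √2 * C₁ * R := by
    rw [neg_mul, abs_neg] at e₁
    have := (le_abs_self _).trans e₁
    have h3 := mul_le_mul_of_nonneg_left this (by positivity : 0 ≤ 2 * √2)
    calc S = 2 * √2 * ((√2)⁻¹ / 2 * S) := by field_simp
      _ ≤ _ := h3
      _ = _ := by ring
  have hTle : |T| ≤ √2 * C₂ * R := by
    rw [neg_mul, abs_neg, abs_mul, abs_of_pos (by positivity : 0 < (√2)⁻¹)] at e₂
    have h3 := mul_le_mul_of_nonneg_left e₂ h2.le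
    calc |T| = √2 * ((√2)⁻¹ * |T|) := by field_simp
      _ ≤ _ := h3
      _ = _ := by ring
  set M := ∑ i, ∫ ω, truncMoment (Y i ω) ∂P with hM
  have hMle : M ≤ 8 * S := by
    rw [hS, Finset.mul_sum]
    exact Finset.sum_le_sum fun i _ => integral_truncMoment_le (hY i) (hY2 i)
  set Q := ∑ i, ∫ ω in {ω | |Y i ω| ≤ 1}, Y i ω ^ 3 ∂P with hQ
  have hQT : |Q - 4 * T| ≤ 4 * M := by
    rw [hQ, hT, hM, Finset.mul_sum, Finset.mul_sum, ← Finset.sum_sub_distrib]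
    exact (Finset.abs_sum_le_sum_abs _ _).trans
      (Finset.sum_le_sum fun i _ => abs_integral_truncated_cube_sub_le (hY i) (hY2 i))
  have hδ : hallBarbourDelta P Y = M + |Q| := by
    rw [hallBarbourDelta, ← Finset.sum_add_distrib, hM]
    congr 1
    exact Finset.sum_congr rfl fun i _ => (integral_truncMoment (hY i) (hY2 i)).symm
  have hQle : |Q| ≤ 4 * M + 4 * |T| := by
    have := abs_add_le (Q - 4 * T) (4 * T)
    rw [sub_add_cancel, abs_mul 4 T, abs_of_pos (by norm_num : (0 : ℝ) < 4)] at this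
    linarith
  rw [hδ]
  linarith

end Truncation

/-! ### Sums of Bernoulli variables and the law of the length -/

section BernoulliSum

open unitInterval

/-- The product law of independent coin tosses with success probabilities `q i`. -/
noncomputable def tossLaw {m : ℕ} (q : Fin m → I) : Measure (Fin m → Bool) :=
  Measure.pi fun i => bernoulliMeasure true false (q i)

instance {m : ℕ} (q : Fin m → I) : IsProbabilityMeasure (tossLaw q) := by
  unfold tossLaw; infer_instance

/-- The indicator of success, as a real number. -/
def success (b : Bool) : ℝ := if b then 1 else 0

theorem measurable_of_bool_pi {m : ℕ} {E : Type*} [MeasurableSpace E]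
    (f : (Fin m → Bool) → E) : Measurable f := measurable_of_finite f

theorem integral_tossLaw_eval {m : ℕ} (q : Fin m → I) {E : Type*} [NormedAddCommGroup E]
    [NormedSpace ℝ E] [CompleteSpace E] (i : Fin m) (f : Bool → E) :
    ∫ ω, f (ω i) ∂(tossLaw q) = (q i : ℝ) • f true + (1 - q i : ℝ) • f false := by
  have h := integral_comp_eval (μ := fun i => bernoulliMeasure true false (q i)) (i := i) (f := f)
    StronglyMeasurable.of_discrete.aestronglyMeasurable
  exact h.trans (integral_bernoulliMeasure true false (q i) f)

theorem memLp_tossLaw {m : ℕ} (q : Fin m → I) (f : (Fin m → Bool) → ℝ) :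
    MemLp f 2 (tossLaw q) := by
  obtain ⟨C, hC⟩ := (Set.finite_range fun ω => ‖f ω‖).bddAbove
  exact MemLp.of_bound (measurable_of_bool_pi f).aestronglyMeasurable C
    (ae_of_all _ fun ω => hC ⟨ω, rfl⟩)

theorem iIndepFun_tossLaw {m : ℕ} (q : Fin m → I) (f : Fin m → Bool → ℝ) :
    iIndepFun (fun i ω => f i (ω i)) (tossLaw q) :=
  iIndepFun_pi fun _ => (measurable_of_finite _).aemeasurable

theorem integral_sum_success {m : ℕ} (q : Fin m → I) :
    ∫ ω, (1 + ∑ i, success (ω i)) ∂(tossLaw q) = 1 + ∑ i, (q i : ℝ) := by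
  rw [integral_add (integrable_const _) ((memLp_tossLaw q _).integrable (by norm_num)),
    integral_finsetSum _ fun i _ => (memLp_tossLaw q _).integrable (by norm_num)]
  have h (i) : ∫ ω, success (ω i) ∂(tossLaw q) = q i := by
    rw [integral_tossLaw_eval q i success]
    simp [success]
  simp [h]

theorem variance_sum_success {m : ℕ} (q : Fin m → I) :
    variance (fun ω => 1 + ∑ i, success (ω i)) (tossLaw q) = ∑ i, (q i : ℝ) * (1 - q i) := by
  have h1 : variance (fun ω => 1 + ∑ i, success (ω i)) (tossLaw q)
      = variance (∑ i, fun ω : Fin m → Bool => success (ω i)) (tossLaw q) := by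
    rw [variance_const_add (measurable_of_bool_pi _).aestronglyMeasurable]
    congr 1
    ext ω
    simp
  rw [h1, IndepFun.variance_sum (fun i _ => memLp_tossLaw q _)
    (fun i _ j _ hij => (iIndepFun_tossLaw q fun _ => success).indepFun hij)]
  refine Finset.sum_congr rfl fun i _ => ?_
  rw [variance_eq_integral (measurable_of_bool_pi _).aemeasurable,
    integral_tossLaw_eval q i (fun b => success b),
    integral_tossLaw_eval q i (fun b => (success b - _) ^ 2)]
  simp only [success, smul_eq_mul, if_true, Bool.false_eq_true, if_false]
  ring

theorem charFun_sum_success {m : ℕ} (q : Fin m → I) (t : ℝ) :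
    charFun ((tossLaw q).map fun ω => 1 + ∑ i, success (ω i)) t
      = Complex.exp (t * Complex.I)
        * ∏ i, ((q i : ℝ) * Complex.exp (t * Complex.I) + (1 - (q i : ℝ))) := by
  have h (i) : charFun ((tossLaw q).map fun ω => success (ω i)) t
      = (q i : ℝ) * Complex.exp (t * Complex.I) + (1 - (q i : ℝ)) := by
    rw [charFun_apply_real, integral_map (measurable_of_bool_pi _).aemeasurable (by fun_prop),
      integral_tossLaw_eval q i (fun b => Complex.exp (t * success b * Complex.I))]
    simp [success]
  rw [charFun_apply_real, integral_map (measurable_of_bool_pi _).aemeasurable (by fun_prop)]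
  have hsum := congrFun ((iIndepFun_tossLaw q fun _ => success).charFun_map_fun_sum_eq_prod
    fun i => (measurable_of_bool_pi _).aemeasurable) t
  rw [charFun_apply_real, integral_map (measurable_of_bool_pi _).aemeasurable (by fun_prop),
    Finset.prod_apply, Finset.prod_congr rfl fun i _ => h i] at hsum
  rw [← hsum, ← integral_const_mul]
  congr 1 with ω
  rw [← Complex.exp_add]
  congr 1
  push_cast
  ring

/-- A Hall–Barbour constant applied to standardized Bernoulli variables: when the variance is at
least one they are bounded by one, so only the third moments are used. -/
theorem IsHallBarbourConstant.abs_third_le {D : ℝ} (hD : IsHallBarbourConstant D) {m : ℕ}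
    (q : Fin m → I) (hq0 : ∀ i, 0 < (q i : ℝ)) (hq1 : ∀ i, (q i : ℝ) < 1) {V : ℝ}
    (hV : ∑ i, (q i : ℝ) * (1 - q i) = V) (hV1 : 1 ≤ V) :
    |∑ i, (q i : ℝ) * (1 - q i) * (1 - 2 * q i)| / √V ^ 3
      ≤ D * (supDist ((tossLaw q).map
          fun ω => ((1 + ∑ i, success (ω i)) - (1 + ∑ i, (q i : ℝ))) / √V) (gaussianReal 0 1)
        + (∑ i, ((q i : ℝ) * (1 - q i)) ^ 2) / V ^ 2) := by
  have hV0 : 0 < V := by linarith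
  have hs1 : 1 ≤ √V := Real.one_le_sqrt.2 hV1
  have hs0 : 0 < √V := by linarith
  have hss : √V ^ 2 = V := Real.sq_sqrt hV0.le
  set Y : Fin m → Bool → ℝ := fun i b => (success b - q i) / √V with hY
  have hYle (i b) : |Y i b| ≤ 1 := by
    rw [hY, abs_div, abs_of_pos hs0, div_le_one hs0]
    refine le_trans ?_ hs1
    have := hq0 i
    have := hq1 i
    cases b <;> simp [success, abs_le] <;> constructor <;> linarith
  have m1 (i) : ∫ ω, Y i (ω i) ∂(tossLaw q) = 0 := by
    rw [integral_tossLaw_eval q i (Y i)]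
    simp only [hY, success, smul_eq_mul, if_true, Bool.false_eq_true, if_false]
    ring
  have m2 (i) : ∫ ω, Y i (ω i) ^ 2 ∂(tossLaw q) = (q i : ℝ) * (1 - q i) / V := by
    rw [integral_tossLaw_eval q i (fun b => Y i b ^ 2)]
    simp only [hY, success, smul_eq_mul, if_true, Bool.false_eq_true, if_false, div_pow, hss]
    ring
  have m3 (i) : ∫ ω, Y i (ω i) ^ 3 ∂(tossLaw q)
      = (q i : ℝ) * (1 - q i) * (1 - 2 * q i) / √V ^ 3 := by
    rw [integral_tossLaw_eval q i (fun b => Y i b ^ 3)]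
    simp only [hY, success, smul_eq_mul, if_true, Bool.false_eq_true, if_false, div_pow]
    ring
  have h := hD.2 (Fin m → Bool) (tossLaw q) m (fun i ω => Y i (ω i))
    (fun i => measurable_of_bool_pi _) (iIndepFun_tossLaw q Y) (fun i => memLp_tossLaw q _) m1
    (fun i => by
      rw [m2]
      exact div_pos (mul_pos (hq0 i) (by linarith [hq1 i])) hV0)
    (by simp only [m2]; rw [← Finset.sum_div, hV, div_self hV0.ne'])
  simp only [m2, div_pow] at h
  rw [← Finset.sum_div] at h
  have hsum : (fun ω : Fin m → Bool => ∑ i, Y i (ω i))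
      = fun ω => ((1 + ∑ i, success (ω i)) - (1 + ∑ i, (q i : ℝ))) / √V := by
    ext ω
    rw [hY, ← Finset.sum_div, Finset.sum_sub_distrib]
    ring
  rw [hsum] at h
  refine le_trans ?_ h
  have huniv (i : Fin m) : {ω : Fin m → Bool | |Y i (ω i)| ≤ 1} = Set.univ :=
    Set.eq_univ_of_forall fun ω => hYle i _
  have h3 : |∑ i, ∫ ω in {ω : Fin m → Bool | |Y i (ω i)| ≤ 1}, Y i (ω i) ^ 3 ∂(tossLaw q)|
      = |∑ i, (q i : ℝ) * (1 - q i) * (1 - 2 * q i)| / √V ^ 3 := by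
    simp only [huniv, setIntegral_univ, m3]
    rw [← Finset.sum_div, abs_div, abs_of_pos (by positivity : 0 < √V ^ 3)]
  rw [hallBarbourDelta, h3]
  refine le_add_of_nonneg_left (add_nonneg ?_ ?_)
  · exact Finset.sum_nonneg fun i _ => integral_nonneg fun _ => by positivity
  · exact Finset.sum_nonneg fun i _ => integral_nonneg fun _ => by positivity

end BernoulliSum

section Law

theorem ascPochhammer_eval_eq_prod {S : Type*} [CommSemiring S] (n : ℕ) (z : S) :
    (ascPochhammer S n).eval z = ∏ j ∈ Finset.range n, (z + j) := by
  induction n with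
  | zero => simp
  | succ n ih => rw [ascPochhammer_succ_eval, ih, Finset.prod_range_succ]

/-- The probability generating function. No sign condition on `θ` is needed: both sides are divided
by the same, possibly zero, number. -/
theorem sum_prob_mul_pow {n : ℕ} (hn : 0 < n) {θ : ℝ} (z : ℂ) :
    ∑ x ∈ Finset.Icc 1 n, (prob n θ x : ℂ) * z ^ x
      = ∏ j ∈ Finset.range n, ((θ * z + j) / (θ + j) : ℂ) := by
  have hcoeff (x : ℕ) : (((ascPochhammer ℝ n).coeff x : ℝ) : ℂ) = (ascPochhammer ℂ n).coeff x := by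
    rw [← ascPochhammer_map Complex.ofRealHom, Polynomial.coeff_map]
    rfl
  have h0 : (ascPochhammer ℂ n).coeff 0 = 0 := by
    rw [Polynomial.coeff_zero_eq_eval_zero, ascPochhammer_ne_zero_eval_zero _ hn.ne']
  have hnum : (ascPochhammer ℂ n).eval (θ * z)
      = ∑ x ∈ Finset.Icc 1 n, (ascPochhammer ℂ n).coeff x * (θ * z) ^ x := by
    rw [Polynomial.eval_eq_sum_range' (n := n + 1)
      (by rw [ascPochhammer_natDegree]; exact Nat.lt_succ_self n), Finset.range_eq_Ico,
      Finset.sum_eq_sum_Ico_succ_bot (Nat.succ_pos n), h0, zero_mul, zero_add]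
    rfl
  have hden : (((ascPochhammer ℝ n).eval θ : ℝ) : ℂ) = ∏ j ∈ Finset.range n, ((θ : ℂ) + j) := by
    rw [ascPochhammer_eval_eq_prod]
    push_cast
    rfl
  rw [Finset.prod_div_distrib, ← ascPochhammer_eval_eq_prod, hnum, Finset.sum_div]
  refine Finset.sum_congr rfl fun x _ => ?_
  rw [prob]
  push_cast
  rw [hcoeff, hden, mul_pow]
  ring

theorem sum_prob {n : ℕ} (hn : 0 < n) {θ : ℝ} (hθ : 0 < θ) :
    ∑ x ∈ Finset.Icc 1 n, prob n θ x = 1 := by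
  have h := sum_prob_mul_pow hn (θ := θ) 1
  rw [Finset.prod_eq_one] at h
  · simp only [one_pow, mul_one] at h
    exact_mod_cast h
  · intro j _
    rw [mul_one, div_self]
    have : 0 < θ + j := by positivity
    exact_mod_cast this.ne'

variable {Ω : Type*} [MeasurableSpace Ω] {P : Measure Ω} [IsProbabilityMeasure P]
  {n : ℕ} {θ : ℝ} {K : Ω → ℕ}

theorem HasEwensLaw.ae_mem (hn : 0 < n) (hθ : 0 < θ) (hK : HasEwensLaw P n θ K) :
    ∀ᵐ ω ∂P, K ω ∈ Finset.Icc 1 n := by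
  have hm : MeasurableSet {ω | K ω ∈ Finset.Icc 1 n} := hK.1 (Set.to_countable _).measurableSet
  have hsum : P.real {ω | K ω ∈ Finset.Icc 1 n} = 1 := by
    have hU : {ω | K ω ∈ Finset.Icc 1 n} = ⋃ x ∈ Finset.Icc 1 n, {ω | K ω = x} := by
      ext ω; simp
    rw [hU, measureReal_biUnion_finset, Finset.sum_congr rfl hK.2, sum_prob hn hθ]
    · intro x _ y _ hxy
      exact Set.disjoint_left.2 fun ω hx hy => hxy (hx.symm.trans hy)
    · exact fun x _ => hK.1 (measurableSet_singleton x)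
  have h1 : P {ω | K ω ∈ Finset.Icc 1 n} = 1 := by
    rw [← ENNReal.toReal_eq_one_iff]; exact hsum
  exact (prob_compl_eq_zero_iff hm).2 h1

theorem HasEwensLaw.integral_eq_sum (hn : 0 < n) (hθ : 0 < θ) (hK : HasEwensLaw P n θ K)
    (g : ℕ → ℂ) : ∫ ω, g (K ω) ∂P = ∑ x ∈ Finset.Icc 1 n, (prob n θ x : ℂ) * g x := by
  have hm (x : ℕ) : MeasurableSet {ω | K ω = x} := hK.1 (measurableSet_singleton x)
  have h1 : (fun ω => g (K ω)) =ᵐ[P]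
      fun ω => ∑ x ∈ Finset.Icc 1 n, {ω | K ω = x}.indicator (fun _ => g x) ω := by
    filter_upwards [hK.ae_mem hn hθ] with ω hω
    rw [Finset.sum_eq_single_of_mem (K ω) hω]
    · simp
    · exact fun x _ hx => Set.indicator_of_notMem (s := {ω | K ω = x}) (fun h => hx h.symm) _
  rw [integral_congr_ae h1, integral_finsetSum _ fun x _ => (integrable_const _).indicator (hm x)]
  refine Finset.sum_congr rfl fun x hx => ?_
  rw [integral_indicator_const _ (hm x), hK.2 x hx, Complex.real_smul]

/-- The success probability `θ / (θ + x)`, for a real argument `x` so that it can be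
differentiated. -/
noncomputable def successProb (θ x : ℝ) : ℝ := θ / (θ + x)

theorem successProb_mem (hθ : 0 < θ) {x : ℝ} (hx : 0 ≤ x) :
    successProb θ x ∈ Set.Icc (0 : ℝ) 1 :=
  ⟨by unfold successProb; positivity, div_le_one_of_le₀ (by linarith) (by positivity)⟩

/-- The length has the law of one plus a sum of independent Bernoulli variables with success
probabilities `θ / (θ + 1), …, θ / (θ + m)`. -/
theorem HasEwensLaw.identDistrib {m : ℕ} (hθ : 0 < θ) (hK : HasEwensLaw P (m + 1) θ K) :
    IdentDistrib (fun ω => (K ω : ℝ)) (fun ω => 1 + ∑ i, success (ω i)) P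
      (tossLaw fun i : Fin m =>
        ⟨successProb θ ((i : ℕ) + 1), successProb_mem hθ (by positivity)⟩) := by
  have hKm : Measurable fun ω => (K ω : ℝ) := (measurable_of_countable Nat.cast).comp hK.1
  refine ⟨hKm.aemeasurable, (measurable_of_bool_pi _).aemeasurable, ?_⟩
  have h1 := Measure.isProbabilityMeasure_map (μ := P) hKm.aemeasurable
  have h2 := Measure.isProbabilityMeasure_map (μ := tossLaw fun i : Fin m =>
        ⟨successProb θ ((i : ℕ) + 1), successProb_mem hθ (by positivity)⟩)
    (measurable_of_bool_pi fun ω => 1 + ∑ i, success (ω i)).aemeasurable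
  refine Measure.ext_of_charFun (funext fun t => ?_)
  rw [charFun_sum_success, charFun_apply_real, integral_map hKm.aemeasurable (by fun_prop)]
  have h3 := hK.integral_eq_sum (Nat.succ_pos m) hθ fun x => Complex.exp (t * Complex.I) ^ x
  have h4 (ω : Ω) : Complex.exp (t * ((K ω : ℝ) : ℂ) * Complex.I)
      = Complex.exp (t * Complex.I) ^ K ω := by
    rw [← Complex.exp_nat_mul]
    congr 1
    push_cast
    ring
  have hθ' : (θ : ℂ) ≠ 0 := by exact_mod_cast hθ.ne'
  simp only [h4]
  rw [h3, sum_prob_mul_pow (Nat.succ_pos m), Finset.prod_range_succ', mul_comm]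
  congr 1
  -- the factor `j = 0` is the deterministic summand one
  · simp only [Nat.cast_zero, add_zero]
    field_simp
  · rw [Finset.prod_range]
    refine Finset.prod_congr rfl fun i _ => ?_
    have h5 : (θ + ((i : ℕ) + 1) : ℂ) ≠ 0 := by
      have : 0 < θ + ((i : ℕ) + 1) := by positivity
      exact_mod_cast this.ne'
    simp only [successProb]
    push_cast
    field_simp
    ring

end Law

/-! ### Comparison of sums with integrals -/

section SumIntegral

/-- Comparison of a sum with an integral, given a primitive `F`: if on `[j, j + 1]` the integrand `f`
falls below `f j` by at most `r j - r (j + 1)`, then these errors telescope. -/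
theorem sum_sub_le_of_hasDerivAt {F f r : ℝ → ℝ} (hF : ∀ x, 0 ≤ x → HasDerivAt F (f x) x)
    (h : ∀ x y z, 0 ≤ x → x ≤ y → y ≤ z → f x - f y ≤ r x - r z) (n : ℕ) :
    ∑ j ∈ Finset.range n, f j - (F n - F 0) ≤ r 0 - r n := by
  induction n with
  | zero => simp
  | succ n ih =>
    have hn : (0 : ℝ) ≤ n := n.cast_nonneg
    obtain ⟨y, hy, hy'⟩ := exists_hasDerivAt_eq_slope F f (lt_add_one (n : ℝ))
      (fun x hx => (hF x (hn.trans hx.1)).continuousAt.continuousWithinAt)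
      (fun x hx => hF x (hn.trans hx.1.le))
    rw [add_sub_cancel_left, div_one] at hy'
    have := h n y (n + 1) hn hy.1.le hy.2.le
    rw [Finset.sum_range_succ]
    push_cast
    linarith

variable {θ : ℝ}

theorem successProb_anti (hθ : 0 < θ) {x y : ℝ} (hx : 0 ≤ x) (hxy : x ≤ y) :
    successProb θ y ≤ successProb θ x :=
  div_le_div_of_nonneg_left hθ.le (by linarith) (by linarith)

theorem successProb_zero (hθ : 0 < θ) : successProb θ 0 = 1 := by
  rw [successProb, add_zero, div_self hθ.ne']

theorem hasDerivAt_successProb (hθ : 0 < θ) {x : ℝ} (hx : 0 ≤ x) :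
    HasDerivAt (successProb θ) (-(successProb θ x ^ 2 / θ)) x := by
  have h0 : θ + x ≠ 0 := by positivity
  have h := ((hasDerivAt_id x).const_add θ).inv h0 |>.const_mul θ
  convert! h using 1
  simp only [successProb, id]
  field_simp

theorem hasDerivAt_log_add (hθ : 0 < θ) {x : ℝ} (hx : 0 ≤ x) :
    HasDerivAt (fun x => θ * Real.log (θ + x)) (successProb θ x) x := by
  have h0 : θ + x ≠ 0 := by positivity
  convert! (((hasDerivAt_id x).const_add θ).log h0).const_mul θ using 1
  simp only [successProb, id]
  ring

/-- An antiderivative of `p (1 - p)`, where `p = θ / (θ + x)`. -/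
noncomputable def varPrimitive (θ x : ℝ) : ℝ := θ * Real.log (θ + x) + θ * successProb θ x

/-- An antiderivative of `p (1 - p) (1 - 2 p)`, where `p = θ / (θ + x)`. -/
noncomputable def thirdPrimitive (θ x : ℝ) : ℝ :=
  θ * Real.log (θ + x) + θ * (3 * successProb θ x - successProb θ x ^ 2)

/-- An antiderivative of `(p (1 - p))²`, where `p = θ / (θ + x)`. -/
noncomputable def fourthPrimitive (θ x : ℝ) : ℝ :=
  θ * (successProb θ x ^ 2 - successProb θ x - successProb θ x ^ 3 / 3)

theorem hasDerivAt_varPrimitive (hθ : 0 < θ) {x : ℝ} (hx : 0 ≤ x) :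
    HasDerivAt (varPrimitive θ) (successProb θ x * (1 - successProb θ x)) x := by
  convert! (hasDerivAt_log_add hθ hx).add ((hasDerivAt_successProb hθ hx).const_mul θ) using 1
  field_simp
  ring

theorem hasDerivAt_thirdPrimitive (hθ : 0 < θ) {x : ℝ} (hx : 0 ≤ x) :
    HasDerivAt (thirdPrimitive θ)
      (successProb θ x * (1 - successProb θ x) * (1 - 2 * successProb θ x)) x := by
  have hp := hasDerivAt_successProb hθ hx
  convert! (hasDerivAt_log_add hθ hx).add (((hp.const_mul 3).sub (hp.pow 2)).const_mul θ) using 1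
  push_cast
  field_simp
  ring

theorem hasDerivAt_fourthPrimitive (hθ : 0 < θ) {x : ℝ} (hx : 0 ≤ x) :
    HasDerivAt (fourthPrimitive θ) ((successProb θ x * (1 - successProb θ x)) ^ 2) x := by
  have hp := hasDerivAt_successProb hθ hx
  convert! (((hp.pow 2).sub hp).sub ((hp.pow 3).div_const 3)).const_mul θ using 1
  push_cast
  field_simp
  ring

theorem log_add_sub_log (hθ : 0 < θ) (n : ℕ) :
    Real.log (θ + n) - Real.log θ = Real.log (1 + n / θ) := by
  rw [← Real.log_div (by positivity) hθ.ne', add_div, div_self hθ.ne']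

theorem varPrimitive_sub (hθ : 0 < θ) (n : ℕ) :
    varPrimitive θ n - varPrimitive θ 0
      = θ * (Real.log (1 + n / θ) - 1 + θ / (n + θ)) := by
  rw [← log_add_sub_log hθ, varPrimitive, varPrimitive, successProb_zero hθ, successProb, add_zero,
    add_comm (n : ℝ) θ]
  ring

theorem thirdPrimitive_sub (hθ : 0 < θ) (n : ℕ) :
    thirdPrimitive θ n - thirdPrimitive θ 0
      = θ * (Real.log (1 + n / θ) - 2 + 3 * θ / (n + θ) - θ ^ 2 / (n + θ) ^ 2) := by
  rw [← log_add_sub_log hθ, thirdPrimitive, thirdPrimitive, successProb_zero hθ, successProb,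
    add_zero, add_comm (n : ℝ) θ]
  generalize θ + (n : ℝ) = s
  ring

theorem fourthPrimitive_sub (hθ : 0 < θ) (n : ℕ) :
    fourthPrimitive θ n - fourthPrimitive θ 0
      = θ * (1 / 3 - θ / (n + θ) + θ ^ 2 / (n + θ) ^ 2 - θ ^ 3 / (3 * (n + θ) ^ 3)) := by
  rw [fourthPrimitive, fourthPrimitive, successProb_zero hθ, successProb, add_comm (n : ℝ) θ]
  generalize θ + (n : ℝ) = s
  ring

theorem abs_var_sub_le {a b : ℝ} (hb : 0 ≤ b) (hba : b ≤ a) (ha : a ≤ 1) :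
    |a * (1 - a) - b * (1 - b)| ≤ a - b := by
  rw [abs_le]
  constructor <;> nlinarith [mul_nonneg hb (sub_nonneg.2 hba)]

/-- One-sided refinement of `abs_var_sub_le`, needed for the constant in `varLower`. -/
theorem neg_le_var_sub {a b : ℝ} (hba : b ≤ a) (ha : a ≤ 1) :
    b * (1 - b) - a * (1 - a) ≤ (a ^ 2 - b ^ 2) / 2 := by
  nlinarith [mul_nonneg (sub_nonneg.2 hba) (by linarith : 0 ≤ 2 - a - b)]

theorem abs_third_sub_le {a b : ℝ} (hb : 0 ≤ b) (hba : b ≤ a) (ha : a ≤ 1) :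
    |a * (1 - a) * (1 - 2 * a) - b * (1 - b) * (1 - 2 * b)| ≤ a - b := by
  have h : a * (1 - a) * (1 - 2 * a) - b * (1 - b) * (1 - 2 * b)
      = (a - b) * (1 - 3 * (a + b) + 2 * (a ^ 2 + a * b + b ^ 2)) := by ring
  rw [h, abs_mul, abs_of_nonneg (sub_nonneg.2 hba)]
  refine mul_le_of_le_one_right (sub_nonneg.2 hba) (abs_le.2 ⟨?_, ?_⟩)
  · nlinarith [sq_nonneg (a + b - 1), sq_nonneg (a - b)]
  · nlinarith [mul_nonneg hb (sub_nonneg.2 ha), mul_nonneg hb (sub_nonneg.2 (hba.trans ha)),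
      mul_nonneg (hb.trans hba) (sub_nonneg.2 ha),
      mul_nonneg (hb.trans hba) (sub_nonneg.2 (hba.trans ha))]

theorem fourth_sub_le {a b : ℝ} (hb : 0 ≤ b) (hba : b ≤ a) (ha : a ≤ 1) :
    (a * (1 - a)) ^ 2 - (b * (1 - b)) ^ 2 ≤ a - b := by
  have h := (le_abs_self _).trans (abs_var_sub_le hb hba ha)
  have h1 : 0 ≤ a * (1 - a) + b * (1 - b) :=
    add_nonneg (mul_nonneg (hb.trans hba) (by linarith)) (mul_nonneg hb (by linarith))
  have h2 : a * (1 - a) + b * (1 - b) ≤ 1 := by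
    nlinarith [sq_nonneg (a - 1 / 2), sq_nonneg (b - 1 / 2)]
  calc _ = (a * (1 - a) - b * (1 - b)) * (a * (1 - a) + b * (1 - b)) := by ring
    _ ≤ (a - b) * (a * (1 - a) + b * (1 - b)) := mul_le_mul_of_nonneg_right h h1
    _ ≤ a - b := mul_le_of_le_one_right (sub_nonneg.2 hba) h2

theorem one_sub_successProb (hθ : 0 < θ) (n : ℕ) : 1 - successProb θ n = n / (n + θ) := by
  have : θ + n ≠ 0 := by positivity
  rw [successProb, add_comm (n : ℝ)]
  field_simp
  ring

/-- The variance of the length. -/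
noncomputable def varSum (n : ℕ) (θ : ℝ) : ℝ :=
  ∑ j ∈ Finset.range n, successProb θ j * (1 - successProb θ j)

/-- The third central moment of the length. -/
noncomputable def thirdSum (n : ℕ) (θ : ℝ) : ℝ :=
  ∑ j ∈ Finset.range n, successProb θ j * (1 - successProb θ j) * (1 - 2 * successProb θ j)

/-- The sum of the squared variances of the Bernoulli summands of the length. -/
noncomputable def fourthSum (n : ℕ) (θ : ℝ) : ℝ :=
  ∑ j ∈ Finset.range n, (successProb θ j * (1 - successProb θ j)) ^ 2

theorem varSum_le_varUpper (hθ : 0 < θ) (n : ℕ) : varSum n θ ≤ varUpper n θ := by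
  have h := sum_sub_le_of_hasDerivAt (fun x hx => hasDerivAt_varPrimitive hθ hx)
    (r := successProb θ) (fun x y z hx hxy hyz => by
      have h1 := (le_abs_self _).trans (abs_var_sub_le (successProb_mem hθ (hx.trans hxy)).1
        (successProb_anti hθ hx hxy) (successProb_mem hθ hx).2)
      linarith [successProb_anti hθ (hx.trans hxy) hyz]) n
  rw [varPrimitive_sub hθ, successProb_zero hθ, one_sub_successProb hθ] at h
  rw [varUpper, varSum, add_comm θ (n : ℝ)]
  linarith

theorem varLower_le_varSum (hθ : 0 < θ) (n : ℕ) : varLower n θ ≤ varSum n θ := by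
  have h := sum_sub_le_of_hasDerivAt (fun x hx => (hasDerivAt_varPrimitive hθ hx).neg)
    (r := fun x => successProb θ x ^ 2 / 2) (fun x y z hx hxy hyz => by
      have h1 := neg_le_var_sub (successProb_anti hθ hx hxy) (successProb_mem hθ hx).2
      have h2 := pow_le_pow_left₀ (successProb_mem hθ ((hx.trans hxy).trans hyz)).1
        (successProb_anti hθ (hx.trans hxy) hyz) 2
      linarith) n
  simp only [Pi.neg_apply, Finset.sum_neg_distrib] at h
  have h3 := varPrimitive_sub hθ n
  have h4 := one_sub_successProb hθ n
  have h5 := successProb_mem hθ n.cast_nonneg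
  have h6 : (n : ℝ) / (2 * (θ + n)) = (n / (n + θ)) / 2 := by
    rw [div_div, add_comm θ, mul_comm]
  rw [varLower, varSum, h6, ← h4, ← h3]
  rw [successProb_zero hθ] at h
  -- with `p = successProb θ n`, what remains is `0 ≤ p (1 + p)`
  nlinarith [h5.1, h5.2]

theorem thirdSum_le_thirdUpper (hθ : 0 < θ) (n : ℕ) : thirdSum n θ ≤ thirdUpper n θ := by
  have h := sum_sub_le_of_hasDerivAt (fun x hx => hasDerivAt_thirdPrimitive hθ hx)
    (r := successProb θ) (fun x y z hx hxy hyz => by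
      have h1 := (le_abs_self _).trans (abs_third_sub_le (successProb_mem hθ (hx.trans hxy)).1
        (successProb_anti hθ hx hxy) (successProb_mem hθ hx).2)
      linarith [successProb_anti hθ (hx.trans hxy) hyz]) n
  rw [thirdPrimitive_sub hθ, successProb_zero hθ, one_sub_successProb hθ] at h
  rw [thirdUpper, thirdSum]
  linarith

theorem thirdLower_le_thirdSum (hθ : 0 < θ) (n : ℕ) : thirdLower n θ ≤ thirdSum n θ := by
  have h := sum_sub_le_of_hasDerivAt (fun x hx => (hasDerivAt_thirdPrimitive hθ hx).neg)
    (r := successProb θ) (fun x y z hx hxy hyz => by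
      have h1 := (neg_le_abs _).trans (abs_third_sub_le (successProb_mem hθ (hx.trans hxy)).1
        (successProb_anti hθ hx hxy) (successProb_mem hθ hx).2)
      linarith [successProb_anti hθ (hx.trans hxy) hyz]) n
  simp only [Pi.neg_apply, Finset.sum_neg_distrib] at h
  have h3 := thirdPrimitive_sub hθ n
  have h4 := one_sub_successProb hθ n
  have h5 := successProb_mem hθ n.cast_nonneg
  have h6 : (n : ℝ) / (2 * (n + θ)) = (n / (n + θ)) / 2 := by
    rw [div_div, mul_comm]
  rw [thirdLower, thirdSum, h6, ← h4, ← h3]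
  rw [successProb_zero hθ] at h
  linarith [h5.1, h5.2]

theorem fourthSum_le (hθ : 0 < θ) (n : ℕ) :
    fourthSum n θ
      ≤ θ * (1 / 3 - θ / (n + θ) + θ ^ 2 / (n + θ) ^ 2 - θ ^ 3 / (3 * (n + θ) ^ 3)) + 2 := by
  have h := sum_sub_le_of_hasDerivAt (fun x hx => hasDerivAt_fourthPrimitive hθ hx)
    (r := successProb θ) (fun x y z hx hxy hyz => by
      have h1 := fourth_sub_le (successProb_mem hθ (hx.trans hxy)).1
        (successProb_anti hθ hx hxy) (successProb_mem hθ hx).2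
      linarith [successProb_anti hθ (hx.trans hxy) hyz]) n
  rw [fourthPrimitive_sub hθ, successProb_zero hθ] at h
  rw [fourthSum]
  linarith [(successProb_mem hθ n.cast_nonneg).1]

theorem sum_range_succ_successProb (hθ : 0 < θ) (f : ℝ → ℝ) (hf : f 1 = 0) (m : ℕ) :
    ∑ j ∈ Finset.range (m + 1), f (successProb θ j)
      = ∑ i : Fin m, f (successProb θ ((i : ℕ) + 1)) := by
  rw [Finset.sum_range_succ', Nat.cast_zero, successProb_zero hθ, hf, add_zero, Finset.sum_range]
  simp

end SumIntegral

/-! ### The lower bounds for the normal approximation error -/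

section LowerBound

variable {Ω : Type*} [MeasurableSpace Ω] {P : Measure Ω} [IsProbabilityMeasure P]
  {n : ℕ} {θ : ℝ} {K : Ω → ℕ}

/-- If the length has variance at least one, then so has its explicit form `varSum`, and the reversed
Berry–Esseen inequality bounds the third central moment. -/
theorem HasEwensLaw.abs_thirdSum_le {D : ℝ} (hD : IsHallBarbourConstant D) (hn : 0 < n)
    (hθ : 0 < θ) (hK : HasEwensLaw P n θ K) (hV : 1 ≤ variance (fun ω => (K ω : ℝ)) P) :
    1 ≤ varSum n θ ∧ |thirdSum n θ| / √(varSum n θ) ^ 3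
      ≤ D * (normalError P K + fourthSum n θ / varSum n θ ^ 2) := by
  obtain ⟨m, rfl⟩ : ∃ m, n = m + 1 := ⟨n - 1, by omega⟩
  have hid := hK.identDistrib hθ
  set q : Fin m → unitInterval :=
    fun i => ⟨successProb θ ((i : ℕ) + 1), successProb_mem hθ (by positivity)⟩ with hq
  have hq0 (i) : 0 < (q i : ℝ) := by
    change 0 < successProb θ _
    unfold successProb
    positivity
  have hq1 (i) : (q i : ℝ) < 1 := by
    change successProb θ _ < 1
    unfold successProb
    rw [div_lt_one (by positivity)]
    have : (0 : ℝ) < ((i : ℕ) : ℝ) + 1 := by positivity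
    linarith
  have e2 : varSum (m + 1) θ = ∑ i, (q i : ℝ) * (1 - q i) :=
    sum_range_succ_successProb hθ (fun p => p * (1 - p)) (by norm_num) m
  have e3 : thirdSum (m + 1) θ = ∑ i, (q i : ℝ) * (1 - q i) * (1 - 2 * q i) :=
    sum_range_succ_successProb hθ (fun p => p * (1 - p) * (1 - 2 * p)) (by norm_num) m
  have e4 : fourthSum (m + 1) θ = ∑ i, ((q i : ℝ) * (1 - q i)) ^ 2 :=
    sum_range_succ_successProb hθ (fun p => (p * (1 - p)) ^ 2) (by norm_num) m
  have hvar : variance (fun ω => (K ω : ℝ)) P = varSum (m + 1) θ := by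
    rw [hid.variance_eq, variance_sum_success, e2]
  have hmean : ∫ ω, (K ω : ℝ) ∂P = 1 + ∑ i, (q i : ℝ) := by
    rw [hid.integral_eq, integral_sum_success]
  have hV1 : 1 ≤ varSum (m + 1) θ := hvar ▸ hV
  have hu : Measurable fun x : ℝ => (x - (1 + ∑ i, (q i : ℝ))) / √(varSum (m + 1) θ) := by
    fun_prop
  have herr : normalError P K = supDist ((tossLaw q).map fun ω =>
      ((1 + ∑ i, success (ω i)) - (1 + ∑ i, (q i : ℝ))) / √(varSum (m + 1) θ))
      (gaussianReal 0 1) := by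
    rw [normalError, hvar, hmean]
    congr 1
    exact (hid.comp hu).map_eq
  refine ⟨hV1, ?_⟩
  rw [herr, e3, e4]
  exact hD.abs_third_le q hq0 hq1 e2.symm hV1

theorem rpow_three_halves {x : ℝ} (hx : 0 ≤ x) : x ^ (3 / 2 : ℝ) = √x ^ 3 := by
  rw [Real.sqrt_eq_rpow, ← Real.rpow_natCast, ← Real.rpow_mul hx]
  norm_num

/-- The lower bound obtained from any lower bound `T` for the absolute third central moment. -/
theorem HasEwensLaw.div_sub_gamma3_le {D : ℝ} (hD : IsHallBarbourConstant D) (hn : 0 < n)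
    (hθ : 0 < θ) (hK : HasEwensLaw P n θ K) (hV : 1 ≤ variance (fun ω => (K ω : ℝ)) P)
    (hL : 0 < varLower n θ) {T : ℝ} (hT : T ≤ |thirdSum n θ|) :
    T / varUpper n θ ^ (3 / 2 : ℝ) / D - gamma3 n θ ≤ normalError P K := by
  obtain ⟨hV1, h⟩ := hK.abs_thirdSum_le hD hn hθ hV
  have hVU := varSum_le_varUpper hθ n
  have hVL := varLower_le_varSum hθ n
  have hs : 0 < √(varSum n θ) := Real.sqrt_pos.2 (by linarith)
  have h4 : 0 ≤ fourthSum n θ := Finset.sum_nonneg fun _ _ => sq_nonneg _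
  have h1 : T / varUpper n θ ^ (3 / 2 : ℝ) ≤ |thirdSum n θ| / √(varSum n θ) ^ 3 := by
    rw [rpow_three_halves (by linarith)]
    gcongr
  have h2 : fourthSum n θ / varSum n θ ^ 2 ≤ gamma3 n θ := by
    rw [gamma3]
    exact div_le_div₀ (h4.trans (fourthSum_le hθ n)) (fourthSum_le hθ n) (by positivity)
      (by gcongr)
  have h3 : T / varUpper n θ ^ (3 / 2 : ℝ) ≤ D * (normalError P K + gamma3 n θ) :=
    (h1.trans h).trans (mul_le_mul_of_nonneg_left (by linarith) hD.1.le)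
  have h5 : T / varUpper n θ ^ (3 / 2 : ℝ) / D ≤ normalError P K + gamma3 n θ := by
    rw [div_le_iff₀ hD.1]
    linarith
  linarith

end LowerBound

end EwensLength

theorem theorem2 :
    (∃ D : ℝ, EwensLength.IsHallBarbourConstant D) ∧
    ∀ D : ℝ, EwensLength.IsHallBarbourConstant D →
      ∀ (n : ℕ) (θ : ℝ), 0 < n → 0 < θ →
      ∀ (Ω : Type*) [MeasurableSpace Ω] (P : Measure Ω) [IsProbabilityMeasure P] (K : Ω → ℕ),
        EwensLength.HasEwensLaw P n θ K →
        0 < EwensLength.varLower n θ →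
        1 ≤ variance (fun ω => (K ω : ℝ)) P →
        (0 < EwensLength.thirdLower n θ →
          EwensLength.gamma2 n θ / D - EwensLength.gamma3 n θ
            ≤ EwensLength.normalError P K) ∧
        (EwensLength.thirdUpper n θ < 0 →
          EwensLength.gamma4 n θ / D - EwensLength.gamma3 n θ
            ≤ EwensLength.normalError P K) := by
  refine ⟨EwensLength.exists_isHallBarbourConstant,
    fun D hD n θ hn hθ Ω _ P _ K hK hL hV => ⟨fun _ => ?_, fun _ => ?_⟩⟩
  · exact hK.div_sub_gamma3_le hD hn hθ hV hL
      ((EwensLength.thirdLower_le_thirdSum hθ n).trans (le_abs_self _))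
  · exact hK.div_sub_gamma3_le hD hn hθ hV hL
      ((neg_le_neg (EwensLength.thirdSum_le_thirdUpper hθ n)).trans (neg_le_abs _))
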